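/- Let $K$ be a field. Let $\mathcal C$ be a unital symmetric operad in chain complexes of $K$-modules ($\mathbb Z$-graded, differential of degree $-1$, Koszul signs, $\mathcal C(0)$ arbitrary), with partial compositions $\gamma_\ell(x,y)=\gamma(1,\dots,1,x,1,\dots,1;y)$ ($x$ in the $\ell$-th place). Let $A$ be a DG $\mathcal C$-algebra, with operations $\theta(a_1,\dots,a_k;c)$ for $c\in\mathcal C(k)$. Consider finite planar rooted trees with vertices numbered $1,\dots,n$ so that, recursively, the vertices of the first successor tree of the root come first, then those of the second one, and so on, and the root is $n$; a set $L$ of vertices of valency $0$ is singled out as the leaves (there may be non-leaf vertices of valency $0$). Write $s(q)$ for the successor of a vertex $q\neq n$, i.e. the vertex directly below it. Label each $i\in L$ by a homogeneous element $x_i\in A$ and each $i\notin L$ of valency $k$ by a homogeneous element $x_i\in\mathcal C(k)$. The *augmented Ginzburg–Kapranov bar construction* $\widetilde B_{\mathcal C}(A)$ is the $K$-module generated by the symbols $$\prod_{i\notin L}e_i\;\prod_{i=1}^n f_i^{|x_i|}\cdot (x_1\otimes\cdots\otimes x_n)$$ for all such labelled trees (products in the order of the vertices), where $e_i^2=0$,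 $e_ie_j=-e_je_i$, $f_i^2=1$, $f_if_j=-f_jf_i$ for $i\ne j$, and $f_je_i=-e_if_j$. The symbols are multilinear in the labels. They are identified under isomorphisms of trees which permute the successor trees of the vertices: such an isomorphism permutes the $e_i$, the $f_i$ and the labels $x_i$, and the labels in $\mathcal C(k)$ are acted upon by the permutation of their inputs. The degree of a symbol is $\sum_i|x_i|+|\{1,\dots,n\}\smallsetminus L|$. Let $d$ be the sum of the following maps. 1. *Edge contractions*, for each non-leaf vertex $q\neq n$: apply $\partial/\partial e_q$, contract the edge from $q$ to $s(q)$, replace the labels $x_q,x_{s(q)}$ by the label $\gamma_\ell(x_q,x_{s(q)})$ of the merged vertex, where $q$ is the $\ell$-th vertex attached to $s(q)$, and in the product of the $f$'s replace the letter $f_q$, where it stands, by the letter $f$ of the merged vertex. 2. *Leaf contractions*, for each non-leaf vertex $r$ (possibly the root) such that all vertices $p,\dots,r-1$ attached to it are leaves (possibly there are none): apply $-\partial/\partial e_r$, replace $r$ and the leaves attached to it by a single leaf labelled $\theta(x_p,\dots,x_{r-1};x_r)$, and replace the letters $f_p,\dots,f_r$ by the letter $f$ of the new leaf. 3. *Internal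 differentials*, for each vertex $i$: multiply from the left by $f_i$ and replace $x_i$ by $\partial x_i$. Then $d$ is a well-defined map of degree $-1$ on the graded $K$-module $\widetilde B_{\mathcal C}(A)$, it satisfies $d\circ d=0$, and $(\widetilde B_{\mathcal C}(A),d)$ is acyclic: $$H(\widetilde B_{\mathcal C}(A),d)=0.$$ -/

import Mathlib

open scoped BigOperators

universe u v w

/-- Substitution of a block into a slot: the `j`-th entry of the sequence `b` (of length `n`) is
replaced by the whole sequence `u` (of length `k`); the result has length `m = n + k - 1`. -/
def splice {α : Type*} {n k m : ℕ} (hm : m + 1 = n + k) (j : Fin n)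
    (b : Fin n → α) (u : Fin k → α) : Fin m → α := fun p =>
  if h₁ : (p : ℕ) < j then b ⟨p, by omega⟩
  else if h₂ : (p : ℕ) < j + k then u ⟨p - j, by omega⟩
  else b ⟨p + 1 - k, by omega⟩

/-- The Koszul sign of rearranging a word with letters of degrees `w 0, …, w (n-1)` into the word
with letters of degrees `w (σ 0), …, w (σ (n-1))`. -/
def koszulSign {n : ℕ} (w : Fin n → ℤ) (σ : Equiv.Perm (Fin n)) : ℤˣ :=
  ∏ i, ∏ j, if i < j ∧ σ j < σ i then (w (σ i) * w (σ j)).negOnePow else 1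

/-- A homogeneous element of a chain complex, together with its degree. -/
abbrev Homog {K : Type u} [Field K] (X : ChainComplex (ModuleCat.{v} K) ℤ) : Type v :=
  Σ d : ℤ, X.X d

/-- The differential of a homogeneous element. -/
noncomputable def Homog.bdry {K : Type u} [Field K] {X : ChainComplex (ModuleCat.{v} K) ℤ}
    (x : Homog X) : Homog X :=
  ⟨x.1 - 1, (X.d x.1 (x.1 - 1)).hom x.2⟩

/-- Unital symmetric operads in chain complexes of `K`-modules, in terms of the unit, the
symmetric group actions and the partial compositions. The element `comp _ j _ x y` is
`γ_j(x, y) = γ(1, …, 1, x, 1, …, 1; y)`: the output of `x` is plugged into the `j`-th input of `y`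
(inputs are numbered from `0`). The equations `hm` and `hr` merely name the arity
`m = n + k - 1` and the degree `r = p + q` of the result. The element `act σ x` is the operation
whose `σ i`-th input is the `i`-th input of `x`. -/
structure DGOperad (K : Type u) [Field K] where
  obj : ℕ → ChainComplex (ModuleCat.{v} K) ℤ
  act : ∀ {n : ℕ}, Equiv.Perm (Fin n) → ∀ {d : ℤ}, (obj n).X d →ₗ[K] (obj n).X d
  unit : (obj 1).X 0
  comp : ∀ {k n m : ℕ} (_ : m + 1 = n + k) (_ : Fin n) {p q r : ℤ} (_ : p + q = r),
    (obj k).X p →ₗ[K] (obj n).X q →ₗ[K] (obj m).X r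
  act_one : ∀ {n : ℕ} {d : ℤ} (x : (obj n).X d), act 1 x = x
  act_mul : ∀ {n : ℕ} {d : ℤ} (σ τ : Equiv.Perm (Fin n)) (x : (obj n).X d),
    act (σ * τ) x = act σ (act τ x)
  act_d : ∀ {n : ℕ} {d d' : ℤ} (σ : Equiv.Perm (Fin n)) (x : (obj n).X d),
    ((obj n).d d d').hom (act σ x) = act σ (((obj n).d d d').hom x)
  unit_d : ∀ d : ℤ, ((obj 1).d 0 d).hom unit = 0
  /-- Partial compositions are chain maps. -/
  comp_d : ∀ {k n m : ℕ} (hm : m + 1 = n + k) (j : Fin n) {p q r p' q' r' : ℤ}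
    (hr : p + q = r) (_ : p' + 1 = p) (_ : q' + 1 = q) (_ : r' + 1 = r)
    (h₁ : p' + q = r') (h₂ : p + q' = r') (x : (obj k).X p) (y : (obj n).X q),
    ((obj m).d r r').hom (comp hm j hr x y) =
      comp hm j h₁ (((obj k).d p p').hom x) y +
        p.negOnePow • comp hm j h₂ x (((obj n).d q q').hom y)
  unit_comp : ∀ {n : ℕ} (hm : n + 1 = n + 1) (j : Fin n) {q : ℤ} (hr : 0 + q = q)
    (y : (obj n).X q), comp hm j hr unit y = y
  comp_unit : ∀ {k : ℕ} (hm : k + 1 = 1 + k) {p : ℤ} (hr : p + 0 = p)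
    (x : (obj k).X p), comp hm 0 hr x unit = x
  /-- Sequential associativity: `γ_i(γ_j(x, y), z) = γ_{i+j}(x, γ_i(y, z))`. -/
  comp_assoc : ∀ {k l n m₁ m₂ m : ℕ} (h₁ : m₁ + 1 = l + k) (h₁' : m + 1 = n + m₁)
    (h₂ : m₂ + 1 = n + l) (h₂' : m + 1 = m₂ + k) (i : Fin n) (j : Fin l) (i' : Fin m₂)
    (_ : (i' : ℕ) = i + j) {p q r s₁ s₂ s : ℤ} (e₁ : p + q = s₁) (e₁' : s₁ + r = s)
    (e₂ : q + r = s₂) (e₂' : p + s₂ = s)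
    (x : (obj k).X p) (y : (obj l).X q) (z : (obj n).X r),
    comp h₁' i e₁' (comp h₁ j e₁ x y) z = comp h₂' i' e₂' x (comp h₂ i e₂ y z)
  /-- Parallel associativity: for `i < j` and `x` of arity `k`,
  `γ_i(x, γ_j(y, z)) = (-1)^{|x||y|} γ_{j+k-1}(y, γ_i(x, z))`. -/
  comp_comm : ∀ {k l n m₁ m₂ m : ℕ} (h₁ : m₁ + 1 = n + l) (h₁' : m + 1 = m₁ + k)
    (h₂ : m₂ + 1 = n + k) (h₂' : m + 1 = m₂ + l) (i j : Fin n) (_ : i < j)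
    (i' : Fin m₁) (_ : (i' : ℕ) = i) (j' : Fin m₂) (_ : (j' : ℕ) + 1 = j + k)
    {p q r s₁ s₂ s : ℤ} (e₁ : q + r = s₁) (e₁' : p + s₁ = s) (e₂ : p + r = s₂)
    (e₂' : q + s₂ = s) (x : (obj k).X p) (y : (obj l).X q) (z : (obj n).X r),
    comp h₁' i' e₁' x (comp h₁ j e₁ y z) =
      (p * q).negOnePow • comp h₂' j' e₂' y (comp h₂ i e₂ x z)
  /-- Equivariance: `γ_{σ j}(τ x, σ y) = π γ_j(x, y)`, where `π` is the permutation of the inputs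
  induced by `σ` and `τ`: it takes the `i`-th input of `y` (for `i ≠ j`) to the `σ i`-th input of
  `σ y`, and the `i`-th input of `x` to the `τ i`-th input of `τ x`. -/
  comp_act : ∀ {k n m : ℕ} (hm : m + 1 = n + k) (j : Fin n) {p q r : ℤ} (hr : p + q = r)
    (τ : Equiv.Perm (Fin k)) (σ : Equiv.Perm (Fin n)) (π : Equiv.Perm (Fin m))
    (_ : ∀ a : Fin m,
      splice hm (σ j) (Sum.inl : Fin n → Fin n ⊕ Fin k) Sum.inr (π a) =
        splice hm j (fun i => Sum.inl (σ i)) (fun i => Sum.inr (τ i)) a)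
    (x : (obj k).X p) (y : (obj n).X q),
    comp hm (σ j) hr (act τ x) (act σ y) = act π (comp hm j hr x y)

/-- DG algebras over the operad `C`: `theta h c a` is `θ(a_1, …, a_n; c)` for `c` in `C(n)` and
homogeneous elements `a_i` of `A`; the equation `h` merely names the degree of the result. -/
structure DGAlgebra {K : Type u} [Field K] (C : DGOperad.{u, v} K) where
  obj : ChainComplex (ModuleCat.{w} K) ℤ
  theta : ∀ {n : ℕ} {d : Fin n → ℤ} {e r : ℤ} (_ : ∑ i, d i + e = r),
    (C.obj n).X e →ₗ[K] MultilinearMap K (fun i => obj.X (d i)) (obj.X r)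
  /-- The operations are chain maps. -/
  theta_d : ∀ {n : ℕ} (a : Fin n → Homog obj) {e e' r r' : ℤ} (h : ∑ i, (a i).1 + e = r)
    (_ : e' + 1 = e) (_ : r' + 1 = r)
    (h₁ : ∀ i, ∑ l, (Function.update a i (a i).bdry l).1 + e = r')
    (h₂ : ∑ i, (a i).1 + e' = r') (c : (C.obj n).X e),
    (obj.d r r').hom (theta h c fun i => (a i).2) =
      ∑ i, (∑ l with l < i, (a l).1).negOnePow •
          theta (h₁ i) c (fun l => (Function.update a i (a i).bdry l).2) +
        (∑ l, (a l).1).negOnePow • theta h₂ (((C.obj n).d e e').hom c) fun i => (a i).2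
  theta_unit : ∀ {d : ℤ} (h : ∑ _i : Fin 1, d + 0 = d) (a : obj.X d),
    theta h C.unit (fun _ => a) = a
  theta_act : ∀ {n : ℕ} {d : Fin n → ℤ} {e r : ℤ} (σ : Equiv.Perm (Fin n))
    (h : ∑ i, d i + e = r) (h' : ∑ i, d (σ i) + e = r) (c : (C.obj n).X e)
    (a : ∀ i, obj.X (d i)),
    theta h (C.act σ c) a = koszulSign d σ • theta h' c (fun i => a (σ i))
  /-- Associativity: if `b_j = θ(u_1, …, u_k; x)` then
  `θ(b_1, …, b_{j-1}, u_1, …, u_k, b_{j+1}, …, b_n; γ_j(x, y)) = ± θ(b_1, …, b_n; y)`, with the sign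
  of moving `x` past `b_{j+1}, …, b_n`. -/
  theta_comp : ∀ {k n m : ℕ} (hm : m + 1 = n + k) (j : Fin n) {p q s r t : ℤ} (hs : p + q = s)
    (b : Fin n → Homog obj) (u : Fin k → Homog obj) (x : (C.obj k).X p) (y : (C.obj n).X q)
    (ht : ∑ i, (u i).1 + p = t) (_ : b j = ⟨t, theta ht x fun i => (u i).2⟩)
    (h : ∑ i, (splice hm j b u i).1 + s = r) (h' : ∑ i, (b i).1 + q = r),
    theta h (C.comp hm j hs x y) (fun i => (splice hm j b u i).2) =
      (p * ∑ i with j < i, (b i).1).negOnePow • theta h' y (fun i => (b i).2)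

section Bar

variable {K : Type u} [Field K] {C : DGOperad.{u, v} K} (A : DGAlgebra.{u, v, w} C)

/-- Planar rooted trees whose leaves are labelled by homogeneous elements of `A`, and whose
non-leaf vertices with `k` successor trees (`k = 0` is allowed) are labelled by homogeneous
elements of `C(k)`. The vertices of a tree are linearly ordered: first those of the first successor
tree of the root, then those of the second one, and so on, and the root comes last.

A labelled tree with vertices `1, …, n`, set of leaves `L` and labels `x_i` stands for
`∏_{i ∉ L} e_i · ∏_i f_i^{|x_i|} · (x_1 ⊗ ⋯ ⊗ x_n)`, the products being taken in the order of the
vertices, where the `e_i` anticommute and have square `0`, the `f_i` anticommute and have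
square `1`, and `f_j e_i = - e_i f_j`. All signs below come from the calculus of these monomials. -/
inductive BarTree : Type (max v w)
  | leaf {d : ℤ} (a : A.obj.X d) : BarTree
  | node {k : ℕ} {d : ℤ} (c : (C.obj k).X d) (ch : Fin k → BarTree) : BarTree

variable {A}

namespace BarTree

/-- The number of non-leaf vertices, i.e. the number of generators `e_i`. -/
def numNodes : BarTree A → ℤ
  | leaf _ => 0
  | node _ ch => ∑ i, numNodes (ch i) + 1

/-- The sum of the degrees of all labels. -/
def labelDeg : BarTree A → ℤ
  | @leaf _ _ _ _ d _ => d
  | @node _ _ _ _ _ d _ ch => ∑ i, labelDeg (ch i) + d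

/-- The degree of a labelled tree in the bar construction: the degree of the tensor product of the
labels, shifted up by the number of non-leaf vertices. -/
def degree (t : BarTree A) : ℤ := t.labelDeg + t.numNodes

def IsLeaf : BarTree A → Prop
  | leaf _ => True
  | node _ _ => False

/-- The label of a leaf, with its degree. -/
def leafLabel : (t : BarTree A) → t.IsLeaf → Homog A.obj
  | @leaf _ _ _ _ d a, _ => ⟨d, a⟩
  | node _ _, h => h.elim

/-- Replacing the `j`-th successor tree, extended linearly to combinations of trees. -/
noncomputable def plug {k : ℕ} {d : ℤ} (c : (C.obj k).X d) (ch : Fin k → BarTree A) (j : Fin k) :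
    (BarTree A →₀ K) →ₗ[K] (BarTree A →₀ K) :=
  Finsupp.lmapDomain K K (fun t => node c (Function.update ch j t))

/-- Contraction of the edge between the root, labelled `c`, and the root `q` of its `j`-th successor
tree `t`, zero if `q` is a leaf. The first two sums count the non-leaf vertices before `q`, which is
the sign of `∂/∂e_q`. The last term is the sign of moving the power of `f_q` to that of the root. -/
noncomputable def rootEdge {k : ℕ} {d : ℤ} (c : (C.obj k).X d) (ch : Fin k → BarTree A)
    (j : Fin k) : BarTree A → (BarTree A →₀ K)
  | leaf _ => 0
  | @node _ _ _ _ l p x ch' =>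
    (∑ i with i < j, numNodes (ch i) + ∑ i, numNodes (ch' i) +
        p * ∑ i with j < i, labelDeg (ch i)).negOnePow •
      Finsupp.single
        (node (C.comp (show k + l - 1 + 1 = k + l by have := j.pos; omega) j rfl x c)
          (splice (show k + l - 1 + 1 = k + l by have := j.pos; omega) j ch ch')) 1

/-- The sum of all edge contractions, with the sign of `∂/∂e_q` for the contraction of the edge from
`q` to its successor. -/
noncomputable def edgeContr : BarTree A → (BarTree A →₀ K)
  | leaf _ => 0
  | node c ch =>
    ∑ j, ((∑ i with i < j, numNodes (ch i)).negOnePow • plug c ch j (edgeContr (ch j)) +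
      rootEdge c ch j (ch j))

open Classical in
/-- The sum of all leaf contractions, with the sign of `∂/∂e_r` for the contraction of the vertex `r`
and the leaves attached to it. -/
noncomputable def leafContr : BarTree A → (BarTree A →₀ K)
  | leaf _ => 0
  | node c ch =>
    ∑ j, (∑ i with i < j, numNodes (ch i)).negOnePow • plug c ch j (leafContr (ch j)) +
      if h : ∀ i, (ch i).IsLeaf then
        Finsupp.single
          (leaf (A.theta (d := fun i => ((ch i).leafLabel (h i)).1) rfl c
            (fun i => ((ch i).leafLabel (h i)).2))) 1
      else 0

/-- The sum over all vertices `i` of the results of applying the internal differential to the label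
`x_i`, with the sign of moving `f_i` past the generators `f_j` of the preceding vertices. -/
noncomputable def internalDiff : BarTree A → (BarTree A →₀ K)
  | @leaf _ _ _ _ d a => Finsupp.single (leaf ((A.obj.d d (d - 1)).hom a)) 1
  | @node _ _ _ _ k d c ch =>
    ∑ j, (∑ i with i < j, labelDeg (ch i)).negOnePow • plug c ch j (internalDiff (ch j)) +
      (∑ i, labelDeg (ch i)).negOnePow •
        Finsupp.single (node (((C.obj k).d d (d - 1)).hom c) ch) 1

/-- The differential of a labelled tree: edge contractions, leaf contractions (with the opposite
sign), and internal differentials, in which `f_i` is also moved past all generators `e_j`. -/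
noncomputable def diff (t : BarTree A) : BarTree A →₀ K :=
  t.edgeContr - t.leafContr + t.numNodes.negOnePow • t.internalDiff

/-- The relations between labelled trees: linearity in the label of each vertex, and the
identification of trees which differ by a permutation of the successor trees of a vertex. The sign
comes from reordering the generators `e_i` and the generators `f_i`. -/
inductive Rel : (BarTree A →₀ K) → Prop
  | leaf_add {d : ℤ} (a b : A.obj.X d) :
      Rel (Finsupp.single (leaf (a + b)) 1 - Finsupp.single (leaf a) 1 -
        Finsupp.single (leaf b) 1)
  | leaf_smul {d : ℤ} (r : K) (a : A.obj.X d) :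
      Rel (Finsupp.single (leaf (r • a)) 1 - Finsupp.single (leaf a) r)
  | node_add {k : ℕ} {d : ℤ} (x y : (C.obj k).X d) (ch : Fin k → BarTree A) :
      Rel (Finsupp.single (node (x + y) ch) 1 - Finsupp.single (node x ch) 1 -
        Finsupp.single (node y ch) 1)
  | node_smul {k : ℕ} {d : ℤ} (r : K) (x : (C.obj k).X d) (ch : Fin k → BarTree A) :
      Rel (Finsupp.single (node (r • x) ch) 1 - Finsupp.single (node x ch) r)
  | node_act {k : ℕ} {d : ℤ} (σ : Equiv.Perm (Fin k)) (x : (C.obj k).X d)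
      (ch : Fin k → BarTree A) :
      Rel (Finsupp.single (node (C.act σ x) ch) 1 -
        (koszulSign (fun i => numNodes (ch i)) σ * koszulSign (fun i => labelDeg (ch i)) σ) •
          Finsupp.single (node x (fun i => ch (σ i))) 1)
  | plug {k : ℕ} {d : ℤ} (x : (C.obj k).X d) (ch : Fin k → BarTree A) (j : Fin k)
      {z : BarTree A →₀ K} (hz : Rel z) : Rel (plug x ch j z)

end BarTree

variable (A)

/-- The underlying `K`-module of the augmented bar construction. -/
abbrev AugBar : Type (max u v w) :=
  (BarTree A →₀ K) ⧸ Submodule.span K {z : BarTree A →₀ K | BarTree.Rel z}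

/-- The class in the augmented bar construction of a linear combination of labelled trees. -/
noncomputable def AugBar.mk : (BarTree A →₀ K) →ₗ[K] AugBar A :=
  Submodule.mkQ _

/-- The part of degree `k` of the augmented bar construction. -/
noncomputable def AugBar.degreePart (k : ℤ) : Submodule K (AugBar A) :=
  Submodule.span K {x | ∃ t : BarTree A, t.degree = k ∧ x = AugBar.mk A (Finsupp.single t 1)}

end Bar

/-! Acyclicity comes from the unit of the operad. Let `h = unitNode` attach a tree `t` to a new
unary root labelled by the unit. Beyond the terms of `h (d t)`, the differential of `h t` contains
one more contribution. If the root of `t` is not a leaf, contracting the new edge returns `t`, by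
the unit axiom; if `t` is a leaf labelled `a`, the leaf contraction returns `t`, because `θ(a; 1) =
a`; and the unit is a cycle. Hence `d h = h d ± 1` (`dBar_unitNode`), so a cycle `x` is the boundary
of `± h x`.

The labour lies in constructing `d` on the quotient and in `d ∘ d = 0`, both with signs. The classes
`cls` carry an extra sign `twist`, which reorders the monomial so that the letters of each vertex
are adjacent. All signs then depend on total degrees only, and reordering successor trees costs the
Koszul sign of these degrees.

In these terms `d` is a derivation for composition. The map `insert c ch j` composes the root
operation of a tree into the `j`-th input of `c`; it kills leaves, and on `h t` it grafts `t` at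
that input. The differential of a node is a signed sum of the terms `insert c ch j (darg (ch j))`,
of the internal differential of `c`, and of the value `eval c ch` in the algebra. Here `darg t = h
(d t) ± (t - leafPart t)`, which is `d (h t)` up to a leaf, accounts at once for the differential
inside `t` and for contracting the edge below `t`.

For `d ∘ d = 0` one argues by induction on the tree. Differentiating the same argument twice gives
`insert c ch j (d (darg t))`, which vanishes by the homotopy formula (`insert_dBar_darg`).
Differentiating two different arguments gives terms cancelling in pairs by parallel associativity
(`sum_cross`). The terms with `∂c` cancel since `∂∂ = 0`, and the terms with `eval` cancel because
the operations of the algebra are chain maps (`dBar_eval`). The Leibniz rule behind this is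
`dBar_insert`. Finally `twist_smul_mk_diff` identifies this `d` with the sum of contractions and
internal differentials in the original signs. -/

/-! ### Signs modulo 2 and partial sums of degrees -/

theorem Int.negOnePow_congr {a b : ℤ} (h : (a : ZMod 2) = b) : a.negOnePow = b.negOnePow := by
  rw [Int.negOnePow_eq_iff, even_iff_two_dvd]
  have : ((a - b : ℤ) : ZMod 2) = 0 := by push_cast; rw [h, sub_self]
  exact_mod_cast (ZMod.intCast_zmod_eq_zero_iff_dvd (a - b) 2).1 this

theorem Int.negOnePow_sum {ι : Type*} (s : Finset ι) (f : ι → ℤ) :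
    (∑ i ∈ s, f i).negOnePow = ∏ i ∈ s, (f i).negOnePow := by
  classical
  induction s using Finset.induction_on with
  | empty => simp
  | insert a s ha ih => rw [Finset.sum_insert ha, Finset.prod_insert ha, Int.negOnePow_add, ih]

/-- The sum of the entries before the `j`-th one. -/
def sumBefore {n : ℕ} (w : Fin n → ℤ) (j : Fin n) : ℤ := ∑ i with i < j, w i

/-- The sum of the entries after the `j`-th one. -/
def sumAfter {n : ℕ} (w : Fin n → ℤ) (j : Fin n) : ℤ := ∑ i with j < i, w i

theorem sumBefore_eq {n : ℕ} (w : Fin n → ℤ) (j : Fin n) :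
    sumBefore w j = ∑ i : {i // i ≠ j}, if i.1 < j then w i.1 else 0 := by
  rw [sumBefore, Finset.sum_filter, Fintype.sum_eq_add_sum_subtype_ne _ j]
  simp

theorem sumAfter_eq {n : ℕ} (w : Fin n → ℤ) (j : Fin n) :
    sumAfter w j = ∑ i : {i // i ≠ j}, if j < i.1 then w i.1 else 0 := by
  rw [sumAfter, Finset.sum_filter, Fintype.sum_eq_add_sum_subtype_ne _ j]
  simp

theorem sum_eq_sumBefore_add {n : ℕ} (w : Fin n → ℤ) (j : Fin n) :
    ∑ i, w i = sumBefore w j + w j + sumAfter w j := by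
  rw [Fintype.sum_eq_add_sum_subtype_ne _ j, sumBefore_eq, sumAfter_eq, add_comm _ (w j),
    add_assoc, ← Finset.sum_add_distrib]
  congr 1
  refine Finset.sum_congr rfl fun i _ => ?_
  rcases lt_or_gt_of_ne i.2 with h | h <;> simp [h, not_lt_of_gt h]

theorem sumBefore_update_self {n : ℕ} (w : Fin n → ℤ) (j : Fin n) (x : ℤ) :
    sumBefore (Function.update w j x) j = sumBefore w j :=
  Finset.sum_congr rfl fun i hi => by
    rw [Function.update_of_ne (ne_of_lt (by simpa using hi))]

theorem sumAfter_update_self {n : ℕ} (w : Fin n → ℤ) (j : Fin n) (x : ℤ) :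
    sumAfter (Function.update w j x) j = sumAfter w j :=
  Finset.sum_congr rfl fun i hi => by
    rw [Function.update_of_ne (ne_of_gt (by simpa using hi))]

theorem sum_update {n : ℕ} (w : Fin n → ℤ) (j : Fin n) (x : ℤ) :
    ∑ i, Function.update w j x i = ∑ i, w i - w j + x := by
  rw [sum_eq_sumBefore_add _ j, sum_eq_sumBefore_add w j, sumBefore_update_self,
    sumAfter_update_self, Function.update_self]
  ring

/-! ### Substitution of a block -/

section Splice

variable {n k m : ℕ} (hm : m + 1 = n + k) (j : Fin n)

/-- The position, after substitution, of an entry of the block. -/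
def spliceIn (a : Fin k) : Fin m := ⟨j + a, by omega⟩

/-- The position, after substitution, of an entry outside of the block. -/
def spliceOut (i : {i : Fin n // i ≠ j}) : Fin m :=
  ⟨if i.1 < j then i.1 else i.1 + k - 1, by
    have h1 := i.1.2
    have h2 : (i.1 : ℕ) ≠ j := fun h => i.2 (Fin.ext h)
    have h3 := j.2
    split_ifs with h
    · have : (i.1 : ℕ) < j := h
      omega
    · have : ¬ (i.1 : ℕ) < j := h
      omega⟩

theorem spliceOut_spliceIn_bijective : Function.Bijective (Sum.elim (spliceOut hm j) (spliceIn hm j)) := by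
  constructor
  · rintro (⟨a, ha⟩ | a) (⟨b, hb⟩ | b) h
    · have h2 : (a : ℕ) ≠ j := fun h => ha (Fin.ext h)
      have h3 : (b : ℕ) ≠ j := fun h => hb (Fin.ext h)
      simp only [Sum.elim_inl, spliceOut, Fin.mk.injEq, Fin.lt_def] at h
      congr 2
      ext
      split_ifs at h <;> omega
    · have h2 : (a : ℕ) ≠ j := fun h => ha (Fin.ext h)
      simp only [Sum.elim_inl, Sum.elim_inr, spliceOut, spliceIn, Fin.mk.injEq, Fin.lt_def] at h
      split_ifs at h <;> omega
    · have h2 : (b : ℕ) ≠ j := fun h => hb (Fin.ext h)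
      simp only [Sum.elim_inl, Sum.elim_inr, spliceOut, spliceIn, Fin.mk.injEq, Fin.lt_def] at h
      split_ifs at h <;> omega
    · simp only [Sum.elim_inr, spliceIn, Fin.mk.injEq] at h
      congr 1
      ext
      omega
  · intro p
    by_cases h1 : (p : ℕ) < j
    · refine ⟨Sum.inl ⟨⟨p, by omega⟩, fun h => ?_⟩, ?_⟩
      · simp [← h] at h1
      · ext
        simp [spliceOut, Fin.lt_def, h1]
    · by_cases h2 : (p : ℕ) < j + k
      · exact ⟨Sum.inr ⟨p - j, by omega⟩, by ext; simp [spliceIn]; omega⟩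
      · refine ⟨Sum.inl ⟨⟨p + 1 - k, by omega⟩, fun h => ?_⟩, ?_⟩
        · simp [← h] at h1 h2
          omega
        · ext
          simp only [Sum.elim_inl, spliceOut, Fin.lt_def]
          split_ifs <;> omega

/-- The positions after substitution are those outside of the block and those in the block. -/
noncomputable def spliceEquiv : {i : Fin n // i ≠ j} ⊕ Fin k ≃ Fin m :=
  Equiv.ofBijective _ (spliceOut_spliceIn_bijective hm j)

@[simp] theorem spliceEquiv_inl (i : {i : Fin n // i ≠ j}) :
    spliceEquiv hm j (Sum.inl i) = spliceOut hm j i := rfl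

@[simp] theorem spliceEquiv_inr (a : Fin k) : spliceEquiv hm j (Sum.inr a) = spliceIn hm j a := rfl

variable {hm j}

@[simp] theorem spliceOut_lt_spliceOut {i i' : {i : Fin n // i ≠ j}} :
    spliceOut hm j i < spliceOut hm j i' ↔ i.1 < i'.1 := by
  obtain ⟨a, ha⟩ := i
  obtain ⟨b, hb⟩ := i'
  have h2 : (a : ℕ) ≠ j := fun h => ha (Fin.ext h)
  have h3 : (b : ℕ) ≠ j := fun h => hb (Fin.ext h)
  simp only [spliceOut, Fin.lt_def]
  split_ifs <;> omega

@[simp] theorem spliceIn_lt_spliceIn {a b : Fin k} :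
    spliceIn hm j a < spliceIn hm j b ↔ a < b := by
  simp [spliceIn]

@[simp] theorem spliceOut_lt_spliceIn {i : {i : Fin n // i ≠ j}} {a : Fin k} :
    spliceOut hm j i < spliceIn hm j a ↔ i.1 < j := by
  obtain ⟨b, hb⟩ := i
  have h3 : (b : ℕ) ≠ j := fun h => hb (Fin.ext h)
  simp only [spliceOut, spliceIn, Fin.lt_def]
  split_ifs <;> omega

@[simp] theorem spliceIn_lt_spliceOut {i : {i : Fin n // i ≠ j}} {a : Fin k} :
    spliceIn hm j a < spliceOut hm j i ↔ j < i.1 := by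
  obtain ⟨b, hb⟩ := i
  have h3 : (b : ℕ) ≠ j := fun h => hb (Fin.ext h)
  simp only [spliceOut, spliceIn, Fin.lt_def]
  split_ifs <;> omega

variable {α : Type*}

@[simp] theorem splice_spliceOut (b : Fin n → α) (u : Fin k → α) (i : {i : Fin n // i ≠ j}) :
    splice hm j b u (spliceOut hm j i) = b i.1 := by
  obtain ⟨a, ha⟩ := i
  have h3 : (a : ℕ) ≠ j := fun h => ha (Fin.ext h)
  by_cases h : (a : ℕ) < j
  · simp [splice, spliceOut, Fin.lt_def, h]
  · have h4 : ¬ (a + k - 1 < (j : ℕ)) := by omega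
    have h5 : ¬ (a + k - 1 < (j : ℕ) + k) := by omega
    simp only [splice, spliceOut, Fin.lt_def, h, if_false, h4, h5, dif_neg, not_false_iff]
    congr 1
    ext
    simp
    omega

@[simp] theorem splice_spliceIn (b : Fin n → α) (u : Fin k → α) (a : Fin k) :
    splice hm j b u (spliceIn hm j a) = u a := by
  simp [splice, spliceIn]

/-- Case distinction between positions outside of the block and in the block. -/
theorem splice_cases {P : Fin m → Prop} (hm : m + 1 = n + k) (j : Fin n)
    (out : ∀ i, P (spliceOut hm j i)) (inn : ∀ a, P (spliceIn hm j a)) (p : Fin m) : P p := by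
  obtain ⟨x | x, rfl⟩ := (spliceEquiv hm j).surjective p
  · exact out x
  · exact inn x

theorem splice_map {β : Type*} (f : α → β) (b : Fin n → α) (u : Fin k → α) :
    (fun p => f (splice hm j b u p)) = splice hm j (fun i => f (b i)) (fun a => f (u a)) := by
  funext p
  induction p using splice_cases hm j <;> simp

theorem splice_update_in (b : Fin n → α) (u : Fin k → α) (a : Fin k) (x : α) :
    splice hm j b (Function.update u a x) =
      Function.update (splice hm j b u) (spliceIn hm j a) x := by
  funext p
  induction p using splice_cases hm j with
  | out i =>
    have : spliceOut hm j i ≠ spliceIn hm j a := fun h => by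
      have := (spliceEquiv hm j).injective (a₁ := Sum.inl i) (a₂ := Sum.inr a) h
      simp at this
    simp [Function.update_of_ne this]
  | inn c =>
    by_cases h : c = a
    · subst h; simp
    · have : spliceIn hm j c ≠ spliceIn hm j a := fun h' => h <| by
        simpa using (spliceEquiv hm j).injective (a₁ := Sum.inr c) (a₂ := Sum.inr a) h'
      simp [Function.update_of_ne this, Function.update_of_ne h]

theorem splice_update_out (b : Fin n → α) (u : Fin k → α) (i : {i : Fin n // i ≠ j}) (x : α) :
    splice hm j (Function.update b i.1 x) u =
      Function.update (splice hm j b u) (spliceOut hm j i) x := by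
  funext p
  induction p using splice_cases hm j with
  | inn a =>
    have : spliceIn hm j a ≠ spliceOut hm j i := fun h => by
      have := (spliceEquiv hm j).injective (a₁ := Sum.inr a) (a₂ := Sum.inl i) h
      simp at this
    simp [Function.update_of_ne this]
  | out c =>
    by_cases h : c = i
    · subst h; simp
    · have h2 : spliceOut hm j c ≠ spliceOut hm j i := fun h' => h <| by
        simpa using (spliceEquiv hm j).injective (a₁ := Sum.inl c) (a₂ := Sum.inl i) h'
      have h3 : c.1 ≠ i.1 := fun h' => h (Subtype.ext h')
      simp [Function.update_of_ne h2, Function.update_of_ne h3]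

theorem splice_update_self (b : Fin n → α) (u : Fin k → α) (x : α) :
    splice hm j (Function.update b j x) u = splice hm j b u := by
  funext p
  induction p using splice_cases hm j with
  | inn a => simp
  | out c => simp [Function.update_of_ne c.2]

variable (hm j) in
theorem sum_splice_index {M : Type*} [AddCommMonoid M] (F : Fin m → M) :
    ∑ p, F p = ∑ i, F (spliceOut hm j i) + ∑ a, F (spliceIn hm j a) := by
  rw [← (spliceEquiv hm j).sum_comp, Fintype.sum_sum_type]
  rfl

variable (hm j) in
theorem prod_splice_index {M : Type*} [CommMonoid M] (F : Fin m → M) :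
    ∏ p, F p = (∏ i, F (spliceOut hm j i)) * ∏ a, F (spliceIn hm j a) := by
  rw [← (spliceEquiv hm j).prod_comp, Fintype.prod_sum_type]
  rfl

theorem sum_splice (b : Fin n → ℤ) (u : Fin k → ℤ) :
    ∑ p, splice hm j b u p = sumBefore b j + sumAfter b j + ∑ a, u a := by
  rw [sum_splice_index hm j]
  simp only [splice_spliceOut, splice_spliceIn]
  have := sum_eq_sumBefore_add b j
  rw [Fintype.sum_eq_add_sum_subtype_ne _ j] at this
  linarith

theorem sumBefore_spliceIn (b : Fin n → ℤ) (u : Fin k → ℤ) (a : Fin k) :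
    sumBefore (splice hm j b u) (spliceIn hm j a) = sumBefore b j + sumBefore u a := by
  rw [sumBefore, Finset.sum_filter, sum_splice_index hm j, sumBefore_eq b j, sumBefore,
    Finset.sum_filter]
  simp

theorem sumAfter_spliceIn (b : Fin n → ℤ) (u : Fin k → ℤ) (a : Fin k) :
    sumAfter (splice hm j b u) (spliceIn hm j a) = sumAfter b j + sumAfter u a := by
  rw [sumAfter, Finset.sum_filter, sum_splice_index hm j, sumAfter_eq b j, sumAfter,
    Finset.sum_filter]
  simp

theorem sumBefore_spliceOut (b : Fin n → ℤ) (u : Fin k → ℤ) (i : {i : Fin n // i ≠ j}) :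
    sumBefore (splice hm j b u) (spliceOut hm j i) =
      sumBefore b i.1 + if j < i.1 then ∑ a, u a - b j else 0 := by
  rw [sumBefore, Finset.sum_filter, sum_splice_index hm j, sumBefore, Finset.sum_filter,
    Fintype.sum_eq_add_sum_subtype_ne _ j]
  by_cases h : j < i.1
  · simp [h]
    ring
  · simp [h]

theorem sumAfter_spliceOut (b : Fin n → ℤ) (u : Fin k → ℤ) (i : {i : Fin n // i ≠ j}) :
    sumAfter (splice hm j b u) (spliceOut hm j i) =
      sumAfter b i.1 + if i.1 < j then ∑ a, u a - b j else 0 := by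
  rw [sumAfter, Finset.sum_filter, sum_splice_index hm j, sumAfter, Finset.sum_filter,
    Fintype.sum_eq_add_sum_subtype_ne _ j]
  by_cases h : i.1 < j
  · simp [h]
    ring
  · simp [h]

end Splice

/-- Substitution into a substituted block. -/
theorem splice_splice_in {α : Type*} {k l n m₁ m₂ m : ℕ} (h₁ : m₁ + 1 = l + k)
    (h₁' : m + 1 = n + m₁) (h₂ : m₂ + 1 = n + l) (h₂' : m + 1 = m₂ + k) (i : Fin n) (j : Fin l)
    (b : Fin n → α) (v : Fin l → α) (u : Fin k → α) :
    splice h₁' i b (splice h₁ j v u) = splice h₂' (spliceIn h₂ i j) (splice h₂ i b v) u := by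
  funext p
  simp only [splice, spliceIn]
  split_ifs <;> first | rfl | omega | (congr 1; ext; simp; omega)

/-- Substitution of two blocks. -/
theorem splice_splice_out {α : Type*} {k l n m₁ m₂ m : ℕ} (h₁ : m₁ + 1 = n + l)
    (h₁' : m + 1 = m₁ + k) (h₂ : m₂ + 1 = n + k) (h₂' : m + 1 = m₂ + l) (i j : Fin n) (hij : i < j)
    (b : Fin n → α) (v : Fin l → α) (u : Fin k → α) :
    splice h₁' (spliceOut h₁ j ⟨i, hij.ne⟩) (splice h₁ j b v) u =
      splice h₂' (spliceOut h₂ i ⟨j, hij.ne'⟩) (splice h₂ i b u) v := by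
  funext p
  have hij' : (i : ℕ) < j := hij
  have hji : ¬ j < i := not_lt_of_gt hij
  simp only [splice, spliceOut, hij, hji, if_true, if_false]
  split_ifs <;> first | rfl | omega | (congr 1; ext; simp; omega) | (rw [dif_pos (by omega)])

/-- This is the condition on `π` in the equivariance axiom, for arbitrary entries; it serves both
for inputs of operations and for successor trees. -/
theorem splice_apply_perm {k n m : ℕ} (hm : m + 1 = n + k) (j : Fin n) (τ : Equiv.Perm (Fin k))
    (σ : Equiv.Perm (Fin n)) (π : Equiv.Perm (Fin m))
    (hout : ∀ i : {i // i ≠ j},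
      π (spliceOut hm j i) = spliceOut hm (σ j) ⟨σ i.1, σ.injective.ne i.2⟩)
    (hin : ∀ a, π (spliceIn hm j a) = spliceIn hm (σ j) (τ a)) {α : Type*}
    (b : Fin n → α) (u : Fin k → α) (p : Fin m) :
    splice hm (σ j) b u (π p) = splice hm j (fun i => b (σ i)) (fun a => u (τ a)) p := by
  induction p using splice_cases hm j with
  | out i => simp [hout]
  | inn a => simp [hin]

/-- The permutation of the inputs of a composition induced by permutations of the inputs of the
factors. -/
theorem exists_splice_perm {k n m : ℕ} (hm : m + 1 = n + k) (j : Fin n) (τ : Equiv.Perm (Fin k))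
    (σ : Equiv.Perm (Fin n)) : ∃ π : Equiv.Perm (Fin m),
      (∀ i : {i // i ≠ j},
        π (spliceOut hm j i) = spliceOut hm (σ j) ⟨σ i.1, σ.injective.ne i.2⟩) ∧
      ∀ a, π (spliceIn hm j a) = spliceIn hm (σ j) (τ a) := by
  refine ⟨(spliceEquiv hm j).symm.trans (((σ.subtypeEquiv fun i => ?_).sumCongr τ).trans
    (spliceEquiv hm (σ j))), fun i => ?_, fun a => ?_⟩
  · exact (σ.injective.ne_iff).symm
  · rw [← spliceEquiv_inl, Equiv.trans_apply, Equiv.symm_apply_apply]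
    rfl
  · rw [← spliceEquiv_inr, Equiv.trans_apply, Equiv.symm_apply_apply]
    rfl

/-! ### Koszul signs -/

/-- The factor of the Koszul sign coming from a pair of letters. -/
def koszulFactor {n : ℕ} (w : Fin n → ℤ) (σ : Equiv.Perm (Fin n)) (i j : Fin n) : ℤˣ :=
  if i < j ∧ σ j < σ i then (w (σ i) * w (σ j)).negOnePow else 1

/-- Singling out the letter that lands in place `j` separates the pairs that do not involve it from
those that do. The latter contribute its degree times the total degree of the letters that cross it.
-/
theorem koszulSign_eq {n : ℕ} (w : Fin n → ℤ) (σ : Equiv.Perm (Fin n)) (j : Fin n) :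
    koszulSign w σ =
      (∏ i : {i // i ≠ j}, ∏ i' : {i // i ≠ j}, koszulFactor w σ i i') *
        (w (σ j) * ∑ i : {i // i ≠ j},
          if i.1 < j ∧ σ j < σ i ∨ j < i.1 ∧ σ i < σ j then w (σ i) else 0).negOnePow := by
  have : koszulSign w σ = ∏ i, ∏ i', koszulFactor w σ i i' := rfl
  rw [this, Fintype.prod_eq_mul_prod_subtype_ne _ j]
  simp only [Fintype.prod_eq_mul_prod_subtype_ne (koszulFactor w σ _) j]
  rw [Finset.prod_mul_distrib, Finset.mul_sum, Int.negOnePow_sum, mul_comm, mul_assoc, mul_left_comm]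
  congr 1
  rw [mul_comm (koszulFactor w σ j j)]
  have : koszulFactor w σ j j = 1 := by simp [koszulFactor]
  rw [this, mul_one, ← Finset.prod_mul_distrib]
  refine Finset.prod_congr rfl fun i _ => ?_
  unfold koszulFactor
  rcases lt_or_gt_of_ne i.2 with h | h
  · by_cases h' : σ j < σ i <;> simp [h, h', not_lt_of_gt, mul_comm]
  · by_cases h' : σ i < σ j <;> simp [h, h', not_lt_of_gt]

/-- A letter crosses the chosen one exactly when it precedes it in one of the two words but not in
the other, so modulo 2 the crossing letters are the difference of two partial sums. -/
theorem sum_inversions {n : ℕ} (w : Fin n → ℤ) (σ : Equiv.Perm (Fin n)) (j : Fin n) :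
    ((∑ i : {i // i ≠ j},
      if i.1 < j ∧ σ j < σ i ∨ j < i.1 ∧ σ i < σ j then w (σ i) else 0 : ℤ) : ZMod 2) =
      sumBefore w (σ j) + sumBefore (fun i => w (σ i)) j := by
  have h1 : sumBefore w (σ j) = ∑ i : {i // i ≠ j}, if σ i.1 < σ j then w (σ i.1) else 0 := by
    rw [sumBefore, Finset.sum_filter, ← Equiv.sum_comp σ, Fintype.sum_eq_add_sum_subtype_ne _ j]
    simp
  rw [h1, sumBefore_eq]
  push_cast
  rw [← Finset.sum_add_distrib]
  refine Finset.sum_congr rfl fun i _ => ?_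
  have hne : σ i ≠ σ j := σ.injective.ne i.2
  rcases lt_or_gt_of_ne i.2 with h | h <;> rcases lt_or_gt_of_ne hne with h' | h' <;>
    (simp [h, h', not_lt_of_gt]; try grind)

/-- The Koszul sign after a change of the degree of one letter. -/
theorem koszulSign_update {n : ℕ} (w : Fin n → ℤ) (σ : Equiv.Perm (Fin n)) (j : Fin n) (x : ℤ) :
    koszulSign (Function.update w (σ j) x) σ = koszulSign w σ *
      ((x - w (σ j)) * (sumBefore w (σ j) + sumBefore (fun i => w (σ i)) j)).negOnePow := by
  rw [koszulSign_eq _ σ j, koszulSign_eq w σ j, mul_assoc, ← Int.negOnePow_add]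
  have hu : ∀ i : {i // i ≠ j}, Function.update w (σ j) x (σ i.1) = w (σ i.1) := fun i =>
    Function.update_of_ne (σ.injective.ne i.2) _ _
  congr 1
  · refine Finset.prod_congr rfl fun i _ => Finset.prod_congr rfl fun i' _ => ?_
    simp only [koszulFactor, hu]
  · simp only [hu, Function.update_self]
    apply Int.negOnePow_congr
    rw [Int.cast_mul, sum_inversions, Int.cast_add, Int.cast_mul, Int.cast_mul, sum_inversions]
    push_cast
    grind

/-- The inserted block first travels as a single letter of total degree `∑ a, u a`, and is then
permuted internally. -/
theorem koszulSign_splice {k n m : ℕ} (hm : m + 1 = n + k) (j : Fin n) (τ : Equiv.Perm (Fin k))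
    (σ : Equiv.Perm (Fin n)) (π : Equiv.Perm (Fin m))
    (hout : ∀ i : {i // i ≠ j},
      π (spliceOut hm j i) = spliceOut hm (σ j) ⟨σ i.1, σ.injective.ne i.2⟩)
    (hin : ∀ a, π (spliceIn hm j a) = spliceIn hm (σ j) (τ a)) (w : Fin n → ℤ) (u : Fin k → ℤ) :
    koszulSign (splice hm (σ j) w u) π =
      koszulSign (Function.update w (σ j) (∑ a, u a)) σ * koszulSign u τ := by
  have hu : ∀ i : {i // i ≠ j}, Function.update w (σ j) (∑ a, u a) (σ i.1) = w (σ i.1) := fun i =>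
    Function.update_of_ne (σ.injective.ne i.2) _ _
  rw [koszulSign_eq _ σ j]
  simp only [koszulFactor, hu, Function.update_self]
  have : koszulSign (splice hm (σ j) w u) π =
    ∏ i, ∏ i', koszulFactor (splice hm (σ j) w u) π i i' := rfl
  rw [this, prod_splice_index hm j]
  simp only [prod_splice_index hm j (koszulFactor _ _ _)]
  rw [Finset.prod_mul_distrib, Finset.prod_mul_distrib]
  simp only [koszulFactor, hout, hin, splice_spliceOut, splice_spliceIn, spliceOut_lt_spliceOut,
    spliceIn_lt_spliceIn, spliceIn_lt_spliceOut, spliceOut_lt_spliceIn]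
  rw [mul_assoc, mul_assoc, ← mul_assoc (∏ i, ∏ i', _) (∏ i, ∏ i', _) (∏ i, ∏ i', _)]
  congr 1
  have h3 : koszulSign u τ =
    ∏ a, ∏ b, if a < b ∧ τ b < τ a then (u (τ a) * u (τ b)).negOnePow else 1 := rfl
  rw [h3]
  congr 1
  rw [Finset.mul_sum, Int.negOnePow_sum, Finset.prod_comm (s := (Finset.univ : Finset (Fin k))),
    ← Finset.prod_mul_distrib]
  refine Finset.prod_congr rfl fun i _ => ?_
  rw [← Finset.prod_mul_distrib, ← Equiv.sum_comp τ u]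
  rcases lt_or_gt_of_ne i.2 with h | h
  · by_cases h' : σ j < σ i
    · simp [h, h', not_lt_of_gt, Finset.sum_mul, Int.negOnePow_sum, mul_comm]
    · simp [h, h', not_lt_of_gt]
  · by_cases h' : σ i < σ j
    · simp [h, h', not_lt_of_gt, Finset.sum_mul, Int.negOnePow_sum]
    · simp [h, h', not_lt_of_gt]

/-- The exponent of the sign of sorting `e₁ f₁ ⋯ eₙ fₙ` into `e₁ ⋯ eₙ f₁ ⋯ fₙ`. -/
def shuffleExp {n : ℕ} (e f : Fin n → ℤ) : ℤ := ∑ j, sumBefore f j * e j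

theorem negOnePow_shuffleExp {n : ℕ} (e f : Fin n → ℤ) :
    (shuffleExp e f).negOnePow = ∏ i, ∏ j, if i < j then (f i * e j).negOnePow else 1 := by
  rw [shuffleExp, Int.negOnePow_sum, Finset.prod_comm]
  refine Finset.prod_congr rfl fun j _ => ?_
  rw [sumBefore, Finset.sum_filter, Finset.sum_mul, Int.negOnePow_sum]
  refine Finset.prod_congr rfl fun i _ => ?_
  split_ifs <;> simp

theorem prod_lt_swap {n : ℕ} {M : Type*} [CommMonoid M] (F : Fin n → Fin n → M) :
    ∏ i, ∏ j, (if i ≠ j then F i j else 1) = ∏ i, ∏ j, if i < j then F i j * F j i else 1 := by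
  have h1 : ∀ i j : Fin n, (if i ≠ j then F i j else 1) =
      (if i < j then F i j else 1) * if j < i then F i j else 1 := by
    intro i j
    rcases lt_trichotomy i j with h | h | h
    · simp [h, h.ne, not_lt_of_gt h]
    · simp [h]
    · simp [h, h.ne', not_lt_of_gt h]
  simp only [h1, Finset.prod_mul_distrib]
  rw [Finset.prod_comm (f := fun i j => if j < i then F i j else 1)]
  simp only [← Finset.prod_mul_distrib]
  refine Finset.prod_congr rfl fun i _ => Finset.prod_congr rfl fun j _ => ?_
  split_ifs <;> simp

/-- The Koszul sign of a permutation of the blocks `eᵢ fᵢ`. -/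
theorem koszulSign_shuffle {n : ℕ} (e f : Fin n → ℤ) (σ : Equiv.Perm (Fin n)) :
    koszulSign e σ * koszulSign f σ * (shuffleExp e f).negOnePow =
      koszulSign (fun i => f i + e i) σ *
        (shuffleExp (fun i => e (σ i)) (fun i => f (σ i))).negOnePow := by
  -- Reindexing by `σ` and collecting the two orders of each pair writes this sign as a product over
  -- `i < j` in the new order, so that the claim can be checked pair by pair.
  have h1 : (shuffleExp e f).negOnePow = ∏ i, ∏ j, if i < j then
      (if σ i < σ j then (f (σ i) * e (σ j)).negOnePow else 1) *
        (if σ j < σ i then (f (σ j) * e (σ i)).negOnePow else 1) else 1 := by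
    have h2 : ∀ i, ∏ j, (if σ i < j then (f (σ i) * e j).negOnePow else 1) =
        ∏ j, if σ i < σ j then (f (σ i) * e (σ j)).negOnePow else 1 := fun i =>
      (Equiv.prod_comp σ fun j => if σ i < j then (f (σ i) * e j).negOnePow else 1).symm
    rw [negOnePow_shuffleExp, ← Equiv.prod_comp σ]
    simp only [h2]
    rw [← prod_lt_swap (fun i j => if σ i < σ j then (f (σ i) * e (σ j)).negOnePow else 1)]
    refine Finset.prod_congr rfl fun i _ => Finset.prod_congr rfl fun j _ => ?_
    by_cases h : i = j
    · simp [h]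
    · simp [h]
  rw [h1, negOnePow_shuffleExp]
  simp only [koszulSign, ← Finset.prod_mul_distrib]
  refine Finset.prod_congr rfl fun i _ => Finset.prod_congr rfl fun j _ => ?_
  by_cases h : i < j
  · have hne : σ i ≠ σ j := σ.injective.ne h.ne
    rcases lt_or_gt_of_ne hne with h' | h'
    · simp [h, h', not_lt_of_gt]
    · simp only [h, h', not_lt_of_gt h', and_self, if_true, if_false, one_mul,
        ← Int.negOnePow_add]
      apply Int.negOnePow_congr
      push_cast
      grind
  · simp [h]

/-! ### Classes normalised by the twist, and maps out of the quotient -/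

section TwistedClasses

variable {K : Type u} [Field K] {C : DGOperad.{u, v} K} {A : DGAlgebra.{u, v, w} C}

namespace BarTree

/-- The sign of rearranging the monomial `∏ e ∏ f` of a labelled tree into the monomial in which
the generators `f` and `e` of each vertex come together. -/
def twist : BarTree A → ℤˣ
  | leaf _ => 1
  | @node _ _ _ _ _ d _ ch => (∏ i, twist (ch i)) *
      (shuffleExp (fun i => numNodes (ch i)) (fun i => labelDeg (ch i)) +
        ∑ i, labelDeg (ch i) + d).negOnePow

@[simp] theorem twist_leaf {d : ℤ} (a : A.obj.X d) : (leaf a : BarTree A).twist = 1 := rfl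

theorem twist_node {k : ℕ} {d : ℤ} (c : (C.obj k).X d) (ch : Fin k → BarTree A) :
    (node c ch).twist = (∏ i, twist (ch i)) *
      (shuffleExp (fun i => numNodes (ch i)) (fun i => labelDeg (ch i)) +
        ∑ i, labelDeg (ch i) + d).negOnePow := by rw [twist]

@[simp] theorem numNodes_leaf {d : ℤ} (a : A.obj.X d) : (leaf a : BarTree A).numNodes = 0 := by
  rw [numNodes]

@[simp] theorem labelDeg_leaf {d : ℤ} (a : A.obj.X d) : (leaf a : BarTree A).labelDeg = d := by
  rw [labelDeg]

theorem numNodes_node {k : ℕ} {d : ℤ} (c : (C.obj k).X d) (ch : Fin k → BarTree A) :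
    (node c ch).numNodes = ∑ i, numNodes (ch i) + 1 := by rw [numNodes]

theorem labelDeg_node {k : ℕ} {d : ℤ} (c : (C.obj k).X d) (ch : Fin k → BarTree A) :
    (node c ch).labelDeg = ∑ i, labelDeg (ch i) + d := by rw [labelDeg]

@[simp] theorem degree_leaf {d : ℤ} (a : A.obj.X d) : (leaf a : BarTree A).degree = d := by
  simp [degree]

theorem degree_node {k : ℕ} {d : ℤ} (c : (C.obj k).X d) (ch : Fin k → BarTree A) :
    (node c ch).degree = ∑ i, degree (ch i) + d + 1 := by
  simp only [degree, numNodes_node, labelDeg_node, Finset.sum_add_distrib]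
  ring

theorem apply_update {β : Type*} (f : BarTree A → β) {k : ℕ} (ch : Fin k → BarTree A) (j : Fin k)
    (t : BarTree A) :
    (fun i => f (Function.update ch j t i)) = Function.update (fun i => f (ch i)) j (f t) := by
  funext i
  exact Function.apply_update (fun _ => f) ch j t i

/-- The part of the sign `twist` of a tree which does not come from its `j`-th successor tree. -/
def twistRest {k : ℕ} (d : ℤ) (ch : Fin k → BarTree A) (j : Fin k) (n l : ℤ) : ℤˣ :=
  (∏ i : {i // i ≠ j}, twist (ch i)) *
    (shuffleExp (Function.update (fun i => numNodes (ch i)) j n)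
        (Function.update (fun i => labelDeg (ch i)) j l) +
      ∑ i, Function.update (fun i => labelDeg (ch i)) j l i + d).negOnePow

/-- Apart from its own twist, the new subtree enters only through its number of nodes and the degree
of its labels, so the remaining factor is constant along a homogeneous relation. -/
theorem twist_node_update {k : ℕ} {d : ℤ} (c : (C.obj k).X d) (ch : Fin k → BarTree A) (j : Fin k)
    (t : BarTree A) : (node c (Function.update ch j t)).twist =
      t.twist * twistRest d ch j t.numNodes t.labelDeg := by
  have h : ∀ i : {i // i ≠ j}, Function.update ch j t i.1 = ch i.1 := fun i =>
    Function.update_of_ne i.2 _ _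
  rw [twist_node, Fintype.prod_eq_mul_prod_subtype_ne _ j, apply_update numNodes,
    apply_update labelDeg]
  simp only [h, Function.update_self, mul_assoc]
  rfl

/-- No relation changes the number of nodes or the total label degree. Signs depending on these two
numbers can therefore be pulled out of a relation inside a subtree. -/
theorem Rel.homogeneous {z : BarTree A →₀ K} (hz : Rel z) :
    ∃ n l : ℤ, ∀ t ∈ z.support, numNodes t = n ∧ labelDeg t = l := by
  classical
  have key : ∀ {n l : ℤ} {z : BarTree A →₀ K},
      (∀ t, z t ≠ 0 → numNodes t = n ∧ labelDeg t = l) →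
      ∃ n l : ℤ, ∀ t ∈ z.support, numNodes t = n ∧ labelDeg t = l := fun h =>
    ⟨_, _, fun t ht => h t (by simpa using ht)⟩
  have single : ∀ {s t : BarTree A} {r : K}, Finsupp.single s r t ≠ 0 → t = s := by
    intro s t r h
    by_contra hne
    exact h (Finsupp.single_eq_of_ne hne)
  have sub : ∀ {f g : BarTree A →₀ K} {t : BarTree A}, (f - g) t ≠ 0 → f t ≠ 0 ∨ g t ≠ 0 := by
    intro f g t h
    by_contra! hne
    exact h (by simp [hne])
  induction hz with
  | @leaf_add d a b =>
    refine key (n := 0) (l := d) fun t ht => ?_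
    rcases sub ht with h | h
    · rcases sub h with h | h <;> rw [single h] <;> simp
    · rw [single h]; simp
  | @leaf_smul d r a =>
    refine key (n := 0) (l := d) fun t ht => ?_
    rcases sub ht with h | h <;> rw [single h] <;> simp
  | @node_add k d x y ch =>
    refine key (n := numNodes (node x ch)) (l := labelDeg (node x ch)) fun t ht => ?_
    rcases sub ht with h | h
    · rcases sub h with h | h <;> rw [single h] <;> simp [numNodes_node, labelDeg_node]
    · rw [single h]; simp [numNodes_node, labelDeg_node]
  | @node_smul k d r x ch =>
    refine key (n := numNodes (node x ch)) (l := labelDeg (node x ch)) fun t ht => ?_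
    rcases sub ht with h | h <;> rw [single h] <;> simp [numNodes_node, labelDeg_node]
  | @node_act k d σ x ch =>
    refine key (n := numNodes (node x ch)) (l := labelDeg (node x ch)) fun t ht => ?_
    rcases sub ht with h | h
    · rw [single h]; simp [numNodes_node, labelDeg_node]
    · have h' : Finsupp.single (node x fun i => ch (σ i)) (1 : K) t ≠ 0 := by
        intro h0
        apply h
        rw [Finsupp.smul_apply, h0, smul_zero]
      rw [single h', numNodes_node, labelDeg_node, numNodes_node, labelDeg_node,
        Equiv.sum_comp σ fun i => numNodes (ch i), Equiv.sum_comp σ fun i => labelDeg (ch i)]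
      exact ⟨rfl, rfl⟩
  | @plug k d x ch j z hz ih =>
    obtain ⟨n, l, h⟩ := ih
    refine ⟨numNodes (node x ch) - numNodes (ch j) + n, labelDeg (node x ch) - labelDeg (ch j) + l,
      fun t ht => ?_⟩
    obtain ⟨s, hs, rfl⟩ := Finset.mem_image.1 (Finsupp.mapDomain_support ht)
    rw [numNodes_node, labelDeg_node, apply_update numNodes, apply_update labelDeg, sum_update,
      sum_update, (h s hs).1, (h s hs).2, numNodes_node, labelDeg_node]
    constructor <;> ring

theorem linearCombination_congr {W : Type*} [AddCommGroup W] [Module K W]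
    {f g : BarTree A → W} {z : BarTree A →₀ K} (h : ∀ t ∈ z.support, f t = g t) :
    Finsupp.linearCombination K f z = Finsupp.linearCombination K g z := by
  rw [Finsupp.linearCombination_apply, Finsupp.linearCombination_apply]
  exact Finset.sum_congr rfl fun t ht => congrArg (z t • ·) (h t ht)

theorem linearCombination_comp {W W' : Type*} [AddCommGroup W] [Module K W]
    [AddCommGroup W'] [Module K W'] (φ : W →ₗ[K] W') (f : BarTree A → W) (z : BarTree A →₀ K) :
    Finsupp.linearCombination K (fun t => φ (f t)) z =
      φ (Finsupp.linearCombination K f z) :=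
  (Finsupp.apply_linearCombination K φ f z).symm

theorem linearCombination_singles (z : BarTree A →₀ K) :
    Finsupp.linearCombination K (fun t : BarTree A => Finsupp.single t (1 : K)) z = z := by
  rw [Finsupp.linearCombination_apply]
  simp [Finsupp.smul_single]

end BarTree

open BarTree

/-- The class of a labelled tree, for the monomial in which the generators `f` and `e` of each
vertex come together. -/
noncomputable def AugBar.cls (t : BarTree A) : AugBar A :=
  t.twist • AugBar.mk A (Finsupp.single t 1)

namespace AugBar

theorem mk_single (t : BarTree A) : mk A (Finsupp.single t 1) = t.twist • cls t := by
  rw [cls, smul_smul, Int.units_mul_self, one_smul]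

theorem mk_eq_zero_of_rel {z : BarTree A →₀ K} (hz : Rel z) : mk A z = 0 :=
  (Submodule.Quotient.mk_eq_zero _).2 (Submodule.subset_span hz)

theorem units_smul_mem {W : Type*} [AddCommGroup W] [Module K W] {S : Submodule K W} {x : W}
    (u : ℤˣ) (hx : x ∈ S) : u • x ∈ S := by
  rw [Units.smul_def]
  exact zsmul_mem hx _

theorem mk_surjective : Function.Surjective (mk A) := Submodule.mkQ_surjective _

theorem mk_eq_linearCombination (z : BarTree A →₀ K) :
    mk A z = Finsupp.linearCombination K (fun t => t.twist • cls t) z := by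
  conv_lhs => rw [← linearCombination_singles z]
  rw [← linearCombination_comp]
  exact linearCombination_congr fun t _ => mk_single t

theorem span_cls : Submodule.span K (Set.range (cls : BarTree A → AugBar A)) = ⊤ := by
  rw [eq_top_iff]
  intro x _
  obtain ⟨z, rfl⟩ := mk_surjective x
  rw [mk_eq_linearCombination, Finsupp.linearCombination_apply]
  refine Submodule.sum_mem _ fun t _ => Submodule.smul_mem _ _ ?_
  exact units_smul_mem _ (Submodule.subset_span ⟨t, rfl⟩)

theorem hom_ext {W : Type*} [AddCommGroup W] [Module K W] {f g : AugBar A →ₗ[K] W}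
    (h : ∀ t, f (cls t) = g (cls t)) : f = g :=
  LinearMap.ext_on_range span_cls h

theorem cls_mem (t : BarTree A) : cls t ∈ degreePart A t.degree := by
  exact units_smul_mem _ (Submodule.subset_span ⟨t, rfl, rfl⟩)

theorem degreePart_eq (k : ℤ) :
    degreePart A k = Submodule.span K (cls '' {t : BarTree A | t.degree = k}) := by
  apply le_antisymm
  · refine Submodule.span_le.2 ?_
    rintro _ ⟨t, ht, rfl⟩
    rw [mk_single]
    exact units_smul_mem _ (Submodule.subset_span ⟨t, ht, rfl⟩)
  · refine Submodule.span_le.2 ?_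
    rintro _ ⟨t, rfl, rfl⟩
    exact cls_mem t

theorem exists_rep {k : ℤ} {x : AugBar A} (hx : x ∈ degreePart A k) :
    ∃ z : BarTree A →₀ K, (∀ t ∈ z.support, t.degree = k) ∧
      Finsupp.linearCombination K cls z = x := by
  rw [degreePart_eq, Finsupp.mem_span_image_iff_linearCombination] at hx
  obtain ⟨z, hz, rfl⟩ := hx
  exact ⟨z, fun t ht => (Finsupp.mem_supported K z).1 hz ht, rfl⟩

theorem eq_of_degreePart {W : Type*} [AddCommGroup W] [Module K W] {f g : AugBar A →ₗ[K] W}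
    {k : ℤ} (h : ∀ t : BarTree A, t.degree = k → f (cls t) = g (cls t)) {x : AugBar A}
    (hx : x ∈ degreePart A k) : f x = g x := by
  rw [degreePart_eq] at hx
  refine LinearMap.eqOn_span (f := f) (g := g) ?_ hx
  rintro _ ⟨t, ht, rfl⟩
  exact h t ht

theorem map_mem_of_degreePart {W : Type*} [AddCommGroup W] [Module K W] {f : AugBar A →ₗ[K] W}
    {S : Submodule K W} {k : ℤ} (h : ∀ t : BarTree A, t.degree = k → f (cls t) ∈ S) {x : AugBar A}
    (hx : x ∈ degreePart A k) : f x ∈ S := by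
  rw [degreePart_eq] at hx
  have : Submodule.span K (cls '' {t : BarTree A | t.degree = k}) ≤ S.comap f := by
    refine Submodule.span_le.2 ?_
    rintro _ ⟨t, ht, rfl⟩
    exact h t ht
  exact this hx

/-! ### Relations between classes -/

theorem cls_leaf_add {d : ℤ} (a b : A.obj.X d) :
    cls (leaf (a + b) : BarTree A) = cls (leaf a) + cls (leaf b) := by
  have := mk_eq_zero_of_rel (Rel.leaf_add a b)
  rw [map_sub, map_sub, sub_sub, sub_eq_zero] at this
  simpa [cls] using this

theorem cls_leaf_smul {d : ℤ} (r : K) (a : A.obj.X d) :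
    cls (leaf (r • a) : BarTree A) = r • cls (leaf a) := by
  have := mk_eq_zero_of_rel (Rel.leaf_smul r a)
  rw [map_sub, sub_eq_zero] at this
  simpa [cls, ← map_smul] using this

theorem cls_node_add {k : ℕ} {d : ℤ} (x y : (C.obj k).X d) (ch : Fin k → BarTree A) :
    cls (node (x + y) ch) = cls (node x ch) + cls (node y ch) := by
  have := mk_eq_zero_of_rel (Rel.node_add x y ch)
  rw [map_sub, map_sub, sub_sub, sub_eq_zero] at this
  simp only [cls, this, smul_add, twist_node]

theorem cls_node_smul {k : ℕ} {d : ℤ} (r : K) (x : (C.obj k).X d) (ch : Fin k → BarTree A) :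
    cls (node (r • x) ch) = r • cls (node x ch) := by
  have := mk_eq_zero_of_rel (Rel.node_smul r x ch)
  rw [map_sub, sub_eq_zero] at this
  have h : Finsupp.single (node x ch) r = r • Finsupp.single (node x ch) (1 : K) := by simp
  rw [cls, this, h, map_smul, smul_comm, cls, twist_node, twist_node]

/-- This is the purpose of the twist: the two separate Koszul signs, for the `e`'s and for the
`f`'s, become one Koszul sign in the total degrees. -/
theorem twist_act {k : ℕ} {d : ℤ} (σ : Equiv.Perm (Fin k)) (x : (C.obj k).X d)
    (ch : Fin k → BarTree A) :
    (node (C.act σ x) ch).twist *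
      (koszulSign (fun i => numNodes (ch i)) σ * koszulSign (fun i => labelDeg (ch i)) σ) =
    koszulSign (fun i => degree (ch i)) σ * (node x fun i => ch (σ i)).twist := by
  have h := koszulSign_shuffle (fun i => numNodes (ch i)) (fun i => labelDeg (ch i)) σ
  rw [twist_node, twist_node, Equiv.prod_comp σ fun i => twist (ch i),
    Equiv.sum_comp σ fun i => labelDeg (ch i)]
  have h' : ∀ a b c : ℤ, (a + b + c).negOnePow = a.negOnePow * (b + c).negOnePow := fun a b c => by
    rw [add_assoc, Int.negOnePow_add]
  rw [h', h']
  calc _ = (∏ i, (ch i).twist) * (∑ i, (ch i).labelDeg + d).negOnePow *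
        (koszulSign (fun i => numNodes (ch i)) σ * koszulSign (fun i => labelDeg (ch i)) σ *
        (shuffleExp (fun i => (ch i).numNodes) fun i => (ch i).labelDeg).negOnePow) := by
        ac_rfl
    _ = _ := by
        rw [h]
        simp only [degree]
        ac_rfl

theorem cls_node_act {k : ℕ} {d : ℤ} (σ : Equiv.Perm (Fin k)) (x : (C.obj k).X d)
    (ch : Fin k → BarTree A) :
    cls (node (C.act σ x) ch) =
      koszulSign (fun i => degree (ch i)) σ • cls (node x fun i => ch (σ i)) := by
  have := mk_eq_zero_of_rel (Rel.node_act σ x ch)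
  rw [map_sub, sub_eq_zero] at this
  rw [cls, this, LinearMap.CompatibleSMul.map_smul, smul_smul, twist_act, mul_smul, ← cls]

end AugBar

/-! ### Maps out of the bar construction -/

/-- The linear map with given values on the classes of trees. -/
noncomputable def AugBar.lift {W : Type*} [AddCommGroup W] [Module K W] (G : BarTree A → W)
    (hG : ∀ z : BarTree A →₀ K, Rel z →
      Finsupp.linearCombination K (fun t => t.twist • G t) z = 0) : AugBar A →ₗ[K] W :=
  Submodule.liftQ _ (Finsupp.linearCombination K fun t => t.twist • G t)
    (Submodule.span_le.2 fun z hz => hG z hz)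

@[simp] theorem AugBar.lift_cls {W : Type*} [AddCommGroup W] [Module K W] (G : BarTree A → W)
    (hG : ∀ z : BarTree A →₀ K, Rel z →
      Finsupp.linearCombination K (fun t => t.twist • G t) z = 0) (t : BarTree A) :
    AugBar.lift G hG (AugBar.cls t) = G t := by
  have : AugBar.lift G hG (AugBar.mk A (Finsupp.single t 1)) = t.twist • G t := by
    rw [AugBar.lift, AugBar.mk]
    simp
  rw [AugBar.cls, LinearMap.CompatibleSMul.map_smul, this, smul_smul, Int.units_mul_self, one_smul]

/-- Functions on labelled trees which are compatible with the relations of the bar construction. -/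
structure BarTree.Compatible {W : Type*} [AddCommGroup W] [Module K W] (G : BarTree A → W) :
    Prop where
  leaf_add : ∀ {d : ℤ} (a b : A.obj.X d), G (leaf (a + b)) = G (leaf a) + G (leaf b)
  leaf_smul : ∀ {d : ℤ} (r : K) (a : A.obj.X d), G (leaf (r • a)) = r • G (leaf a)
  node_add : ∀ {k : ℕ} {d : ℤ} (x y : (C.obj k).X d) (ch : Fin k → BarTree A),
    G (node (x + y) ch) = G (node x ch) + G (node y ch)
  node_smul : ∀ {k : ℕ} {d : ℤ} (r : K) (x : (C.obj k).X d) (ch : Fin k → BarTree A),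
    G (node (r • x) ch) = r • G (node x ch)
  node_act : ∀ {k : ℕ} {d : ℤ} (σ : Equiv.Perm (Fin k)) (x : (C.obj k).X d)
    (ch : Fin k → BarTree A), G (node (C.act σ x) ch) =
      koszulSign (fun i => degree (ch i)) σ • G (node x fun i => ch (σ i))
  update : ∀ {k : ℕ} {d : ℤ} (x : (C.obj k).X d) (ch : Fin k → BarTree A) (j : Fin k) (e : ℤ),
    ∃ Φ : AugBar A × W →ₗ[K] W, ∀ t : BarTree A, t.degree = e →
      G (node x (Function.update ch j t)) = Φ (AugBar.cls t, G t)

/-- Only relations inside a subtree need an argument. By `update`, the value at the large tree is a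
fixed linear function of the class and the value of the subtree, as long as the degree of the
subtree is fixed; it is fixed by homogeneity. -/
theorem BarTree.Compatible.rel {W : Type*} [AddCommGroup W] [Module K W] {G : BarTree A → W}
    (hG : Compatible G) (z : BarTree A →₀ K) (hz : Rel z) :
    Finsupp.linearCombination K (fun t => t.twist • G t) z = 0 := by
  induction hz with
  | leaf_add a b => simp [hG.leaf_add]
  | leaf_smul r a => simp [hG.leaf_smul]
  | node_add x y ch => simp [hG.node_add, twist_node]
  | node_smul r x ch => simp [hG.node_smul, twist_node, smul_comm r]
  | node_act σ x ch =>
    rw [map_sub, LinearMap.CompatibleSMul.map_smul, Finsupp.linearCombination_single,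
      Finsupp.linearCombination_single, one_smul, one_smul, hG.node_act, smul_smul, smul_smul,
      sub_eq_zero]
    congr 1
    have h := AugBar.twist_act σ x ch
    generalize koszulSign (fun i => numNodes (ch i)) σ * koszulSign (fun i => labelDeg (ch i)) σ = s
      at h ⊢
    generalize koszulSign (fun i => degree (ch i)) σ = s' at h ⊢
    rw [← mul_one (_ * s'), ← Int.units_mul_self s]
    calc _ = s * ((node (C.act σ x) ch).twist * s) * s' := by ac_rfl
      _ = s * (node x fun i => ch (σ i)).twist * (s' * s') := by rw [h]; ac_rfl
      _ = _ := by rw [Int.units_mul_self, mul_one]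
  | @plug k d x ch j z hz ih =>
    obtain ⟨n, l, h⟩ := hz.homogeneous
    obtain ⟨Φ, hΦ⟩ := hG.update x ch j (l + n)
    have h1 : Finsupp.linearCombination K (fun t => t.twist • G t) (BarTree.plug x ch j z) =
        Finsupp.linearCombination K (fun t => (node x (Function.update ch j t)).twist •
          G (node x (Function.update ch j t))) z := by
      rw [BarTree.plug, Finsupp.lmapDomain_apply, Finsupp.linearCombination_mapDomain]
      rfl
    have h2 : ∀ t ∈ z.support, (node x (Function.update ch j t)).twist •
        G (node x (Function.update ch j t)) =
        ((twistRest d ch j n l : ℤˣ) • Φ) (t.twist • (AugBar.cls t, G t)) := by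
      intro t ht
      rw [twist_node_update, (h t ht).1, (h t ht).2,
        hΦ t (by rw [degree, (h t ht).1, (h t ht).2]), mul_comm, mul_smul, LinearMap.smul_apply,
        LinearMap.CompatibleSMul.map_smul]
    rw [h1, linearCombination_congr h2, linearCombination_comp]
    -- The first component vanishes because `z` is a relation, the second by induction.
    have h3 : Finsupp.linearCombination K (fun t => t.twist • (AugBar.cls t, G t)) z = 0 := by
      apply Prod.ext
      · have := linearCombination_comp (LinearMap.fst K (AugBar A) W)
          (fun t => t.twist • (AugBar.cls t, G t)) z
        refine this.symm.trans ?_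
        exact (AugBar.mk_eq_linearCombination z).symm.trans (AugBar.mk_eq_zero_of_rel hz)
      · have := linearCombination_comp (LinearMap.snd K (AugBar A) W)
          (fun t => t.twist • (AugBar.cls t, G t)) z
        exact this.symm.trans ih
    rw [h3, map_zero]

namespace AugBar

/-- Replacing the `j`-th successor tree. -/
noncomputable def graft {k : ℕ} {d : ℤ} (c : (C.obj k).X d) (ch : Fin k → BarTree A) (j : Fin k) :
    AugBar A →ₗ[K] AugBar A :=
  lift (fun t => cls (node c (Function.update ch j t))) fun z hz => by
    obtain ⟨n, l, h⟩ := hz.homogeneous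
    have h1 : ∀ t ∈ z.support, t.twist • cls (node c (Function.update ch j t)) =
        ((twistRest d ch j n l : ℤˣ) • mk A) (BarTree.plug c ch j (Finsupp.single t 1)) := by
      intro t ht
      rw [cls, twist_node_update, (h t ht).1, (h t ht).2, smul_smul, ← mul_assoc,
        Int.units_mul_self, one_mul, BarTree.plug, Finsupp.lmapDomain_apply,
        Finsupp.mapDomain_single, LinearMap.smul_apply]
    rw [linearCombination_congr h1, linearCombination_comp, linearCombination_comp]
    rw [linearCombination_singles, LinearMap.smul_apply, mk_eq_zero_of_rel (hz.plug c ch j),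
      smul_zero]

@[simp] theorem graft_cls {k : ℕ} {d : ℤ} (c : (C.obj k).X d) (ch : Fin k → BarTree A) (j : Fin k)
    (t : BarTree A) : graft c ch j (cls t) = cls (node c (Function.update ch j t)) :=
  lift_cls _ _ _

end AugBar

end TwistedClasses

/-! ### Composition into an input as a linear map -/

section Composition

variable {K : Type u} [Field K] {C : DGOperad.{u, v} K} {A : DGAlgebra.{u, v, w} C}

open BarTree

namespace AugBar

theorem cls_node_units_smul {k : ℕ} {d : ℤ} (r : ℤˣ) (x : (C.obj k).X d)
    (ch : Fin k → BarTree A) : cls (node (r • x) ch) = r • cls (node x ch) := by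
  rcases Int.units_eq_one_or r with rfl | rfl
  · simp
  · simpa using cls_node_smul (-1) x ch

/-- The degrees of the successor trees. -/
abbrev degs {k : ℕ} (ch : Fin k → BarTree A) : Fin k → ℤ := fun i => degree (ch i)

theorem degs_update {k : ℕ} (ch : Fin k → BarTree A) (j : Fin k) (t : BarTree A) :
    degs (Function.update ch j t) = Function.update (degs ch) j t.degree :=
  apply_update degree ch j t

theorem degs_splice {k n m : ℕ} (hm : m + 1 = n + k) (j : Fin n) (ch : Fin n → BarTree A)
    (u : Fin k → BarTree A) : degs (splice hm j ch u) = splice hm j (degs ch) (degs u) :=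
  splice_map degree ch u

/-- Arity and degree of a composite are determined by the factors. This allows `insert` to use fixed
expressions for them while later statements name them freely. -/
theorem node_comp_congr {k n m m' : ℕ} (hm : m + 1 = n + k) (hm' : m' + 1 = n + k) (j : Fin n)
    {p q r r' : ℤ} (hr : p + q = r) (hr' : p + q = r') (x : (C.obj k).X p) (c : (C.obj n).X q)
    (ch : Fin n → BarTree A) (u : Fin k → BarTree A) :
    node (C.comp hm j hr x c) (splice hm j ch u) =
      node (C.comp hm' j hr' x c) (splice hm' j ch u) := by
  obtain rfl : m = m' := by omega
  obtain rfl : r = r' := by omega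
  rfl

/-- The operadic equivariance moves the successor trees `u` as one block, whose letter has degree `∑
i, degs u i`; the sign is that of `koszulSign_splice`. -/
theorem cls_comp_act {k n m : ℕ} (hm : m + 1 = n + k) (j : Fin n) {p q r : ℤ} (hr : p + q = r)
    (τ : Equiv.Perm (Fin k)) (σ : Equiv.Perm (Fin n)) (x : (C.obj k).X p) (c : (C.obj n).X q)
    (ch : Fin n → BarTree A) (u : Fin k → BarTree A) :
    cls (node (C.comp hm (σ j) hr (C.act τ x) (C.act σ c)) (splice hm (σ j) ch u)) =
      (koszulSign (Function.update (degs ch) (σ j) (∑ i, degs u i)) σ * koszulSign (degs u) τ) •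
        cls (node (C.comp hm j hr x c)
          (splice hm j (fun i => ch (σ i)) (fun i => u (τ i)))) := by
  obtain ⟨π, hout, hin⟩ := exists_splice_perm hm j τ σ
  rw [C.comp_act hm j hr τ σ π (splice_apply_perm hm j τ σ π hout hin _ _), cls_node_act]
  congr 1
  · rw [← koszulSign_splice hm j τ σ π hout hin]
    exact congrArg (koszulSign · π) (degs_splice hm (σ j) ch u)
  · congr 2
    funext p
    exact splice_apply_perm hm j τ σ π hout hin ch u p

/-- Composition of the root of a tree, as an operation, with an operation `c` with arguments `ch`,
in the `j`-th place; a leaf is sent to zero. -/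
noncomputable def insertFun {n : ℕ} {q : ℤ} (c : (C.obj n).X q) (ch : Fin n → BarTree A)
    (j : Fin n) : BarTree A → AugBar A
  | leaf _ => 0
  | @node _ _ _ _ k p x u => (p * sumAfter (degs ch) j).negOnePow •
      cls (node (C.comp (show n + k - 1 + 1 = n + k by have := j.pos; omega) j rfl x c)
        (splice (show n + k - 1 + 1 = n + k by have := j.pos; omega) j ch u))

theorem insertFun_compatible {n : ℕ} {q : ℤ} (c : (C.obj n).X q) (ch : Fin n → BarTree A)
    (j : Fin n) : Compatible (insertFun c ch j) where
  leaf_add a b := by simp [insertFun]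
  leaf_smul r a := by simp [insertFun]
  node_add x y u := by simp [insertFun, cls_node_add]
  node_smul r x u := by simp [insertFun, cls_node_smul, smul_comm r]
  node_act {k p} τ x u := by
    have hm : n + k - 1 + 1 = n + k := by have := j.pos; omega
    have := cls_comp_act hm j rfl τ 1 x c ch u
    rw [C.act_one] at this
    have h1 : ∀ w : Fin n → ℤ, koszulSign w 1 = 1 := fun w => by
      refine Finset.prod_eq_one fun i _ => Finset.prod_eq_one fun j _ => if_neg ?_
      rintro ⟨h, h'⟩
      exact absurd h (not_lt_of_gt h')
    rw [h1, one_mul] at this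
    simp only [insertFun]
    rw [smul_comm]
    congr 1
  update {k p} x u a e := by
    have hm : n + k - 1 + 1 = n + k := by have := j.pos; omega
    refine ⟨((p * sumAfter (degs ch) j).negOnePow • graft (C.comp hm j rfl x c) (splice hm j ch u)
      (spliceIn hm j a)) ∘ₗ LinearMap.fst K _ _, fun t _ => ?_⟩
    simp only [insertFun]
    simp [splice_update_in]

/-- Composition of the root of a tree, as an operation, with an operation `c` with arguments `ch`,
in the `j`-th place. -/
noncomputable def insert {n : ℕ} {q : ℤ} (c : (C.obj n).X q) (ch : Fin n → BarTree A)
    (j : Fin n) : AugBar A →ₗ[K] AugBar A :=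
  lift _ (insertFun_compatible c ch j).rel

@[simp] theorem insert_leaf {n : ℕ} {q : ℤ} (c : (C.obj n).X q) (ch : Fin n → BarTree A)
    (j : Fin n) {d : ℤ} (a : A.obj.X d) : insert c ch j (cls (leaf a)) = 0 := by
  rw [insert, lift_cls, insertFun]

theorem insert_node {k n m : ℕ} (hm : m + 1 = n + k) (j : Fin n) {p q r : ℤ} (hr : p + q = r)
    (x : (C.obj k).X p) (c : (C.obj n).X q) (ch : Fin n → BarTree A) (u : Fin k → BarTree A) :
    insert c ch j (cls (node x u)) = (p * sumAfter (degs ch) j).negOnePow •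
      cls (node (C.comp hm j hr x c) (splice hm j ch u)) := by
  rw [insert, lift_cls, insertFun]
  congr 2
  exact node_comp_congr _ _ _ _ _ _ _ _ _

/-- Linear maps agree if they agree on leaves and on nodes. -/
theorem hom_ext' {W : Type*} [AddCommGroup W] [Module K W] {f g : AugBar A →ₗ[K] W}
    (hl : ∀ {d : ℤ} (a : A.obj.X d), f (cls (leaf a)) = g (cls (leaf a)))
    (hn : ∀ {k : ℕ} {d : ℤ} (x : (C.obj k).X d) (u : Fin k → BarTree A),
      f (cls (node x u)) = g (cls (node x u))) : f = g :=
  hom_ext fun t => by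
    cases t with
    | leaf a => exact hl a
    | node x u => exact hn x u

theorem insert_add {n : ℕ} {q : ℤ} (c c' : (C.obj n).X q) (ch : Fin n → BarTree A) (j : Fin n) :
    insert (c + c') ch j = insert c ch j + insert c' ch j := by
  refine hom_ext' (fun a => by simp) fun {k p} x u => ?_
  have hm : n + k - 1 + 1 = n + k := by have := j.pos; omega
  rw [LinearMap.add_apply, insert_node hm j rfl, insert_node hm j rfl, insert_node hm j rfl,
    map_add, cls_node_add, smul_add]

theorem insert_smul {n : ℕ} {q : ℤ} (s : K) (c : (C.obj n).X q) (ch : Fin n → BarTree A)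
    (j : Fin n) : insert (s • c) ch j = s • insert c ch j := by
  refine hom_ext' (fun a => by simp) fun {k p} x u => ?_
  have hm : n + k - 1 + 1 = n + k := by have := j.pos; omega
  rw [LinearMap.smul_apply, insert_node hm j rfl, insert_node hm j rfl,
    map_smul, cls_node_smul, smul_comm]

theorem insert_update_self {n : ℕ} {q : ℤ} (c : (C.obj n).X q) (ch : Fin n → BarTree A)
    (j : Fin n) (t : BarTree A) : insert c (Function.update ch j t) j = insert c ch j := by
  refine hom_ext' (fun a => by simp) fun {k p} x u => ?_
  have hm : n + k - 1 + 1 = n + k := by have := j.pos; omega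
  rw [insert_node hm j rfl, insert_node hm j rfl, splice_update_self, degs_update,
    sumAfter_update_self]

/-- Varying a successor tree away from the insertion place is a graft when `y` is the class of a
node, and general `y` follow by linearity. The degree is fixed because the sign of `insert` involves
the degrees of the later trees. -/
theorem exists_insert_update {n : ℕ} {q : ℤ} (c : (C.obj n).X q) (ch : Fin n → BarTree A)
    (j i : Fin n) (hij : i ≠ j) (e : ℤ) (y : AugBar A) :
    ∃ Φ : AugBar A →ₗ[K] AugBar A, ∀ t : BarTree A, t.degree = e →
      insert c (Function.update ch j t) i y = Φ (cls t) := by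
  have hy : y ∈ Submodule.span K (Set.range (cls : BarTree A → AugBar A)) := by
    rw [span_cls]; trivial
  induction hy using Submodule.span_induction with
  | zero => exact ⟨0, fun t _ => by simp⟩
  | add x y _ _ hx hy =>
    obtain ⟨Φ, hΦ⟩ := hx
    obtain ⟨Ψ, hΨ⟩ := hy
    exact ⟨Φ + Ψ, fun t ht => by rw [map_add, hΦ t ht, hΨ t ht, LinearMap.add_apply]⟩
  | smul r x _ hx =>
    obtain ⟨Φ, hΦ⟩ := hx
    exact ⟨r • Φ, fun t ht => by rw [map_smul, hΦ t ht, LinearMap.smul_apply]⟩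
  | mem x hx =>
    obtain ⟨s, rfl⟩ := hx
    cases s with
    | leaf a => exact ⟨0, fun t _ => by simp⟩
    | @node k p x u =>
      have hm : n + k - 1 + 1 = n + k := by have := j.pos; omega
      refine ⟨(p * sumAfter (Function.update (degs ch) j e) i).negOnePow •
        graft (C.comp hm i rfl x c) (splice hm i ch u) (spliceOut hm i ⟨j, hij.symm⟩),
        fun t ht => ?_⟩
      rw [insert_node hm i rfl, LinearMap.smul_apply, graft_cls, degs_update, ht,
        splice_update_out (hm := hm) (j := i) ch u ⟨j, hij.symm⟩ t]

/-- Composition absorbs the root of the inserted tree and with it one generator `e`, so an argument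
of degree `e + 1` counts as a letter of degree `e`: the successors together with the root label. -/
theorem insert_act {n : ℕ} {q : ℤ} (c : (C.obj n).X q) (ch : Fin n → BarTree A) (j : Fin n)
    (σ : Equiv.Perm (Fin n)) {e : ℤ} {y : AugBar A} (hy : y ∈ degreePart A (e + 1)) :
    insert (C.act σ c) ch (σ j) y =
      koszulSign (Function.update (degs ch) (σ j) e) σ • insert c (fun i => ch (σ i)) j y := by
  rw [← LinearMap.smul_apply]
  refine eq_of_degreePart (fun t ht => ?_) hy
  cases t with
  | leaf a => simp
  | @node k p x u =>
    have hm : n + k - 1 + 1 = n + k := by have := j.pos; omega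
    have := cls_comp_act hm j rfl 1 σ x c ch u
    rw [C.act_one] at this
    have h1 : koszulSign (degs u) 1 = 1 := by
      refine Finset.prod_eq_one fun i _ => Finset.prod_eq_one fun j _ => if_neg ?_
      rintro ⟨h, h'⟩
      exact absurd h (not_lt_of_gt h')
    rw [LinearMap.smul_apply, insert_node hm _ rfl, insert_node hm _ rfl, this, h1, mul_one,
      smul_smul, smul_smul]
    congr 1
    rw [degree_node] at ht
    obtain rfl : e = ∑ i, degs u i + p := by
      simp only [degs]
      omega
    have s1 := sum_eq_sumBefore_add (degs ch) (σ j)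
    have s2 := sum_eq_sumBefore_add (fun i => degs ch (σ i)) j
    rw [Equiv.sum_comp σ (degs ch), s1] at s2
    rw [koszulSign_update, koszulSign_update, mul_left_comm, mul_assoc, ← Int.negOnePow_add,
      ← Int.negOnePow_add]
    congr 1
    apply Int.negOnePow_congr
    have s3 := congrArg (Int.cast : ℤ → ZMod 2) s2
    push_cast at s3 ⊢
    have s4 : degs (fun i => ch (σ i)) = fun i => degs ch (σ i) := rfl
    rw [s4]
    generalize (sumBefore (degs ch) (σ j) : ZMod 2) = b at *
    generalize (sumAfter (degs ch) (σ j) : ZMod 2) = a at *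
    generalize (sumBefore (fun i => degs ch (σ i)) j : ZMod 2) = b' at *
    generalize (sumAfter (fun i => degs ch (σ i)) j : ZMod 2) = a' at *
    -- Both words have the same total degree and the same chosen letter, so one of the four partial
    -- sums can be eliminated.
    obtain rfl : a = b' + a' - b := by linear_combination s3
    grind

theorem insert_mem {n : ℕ} {q : ℤ} (c : (C.obj n).X q) (ch : Fin n → BarTree A) (j : Fin n)
    {e f : ℤ} {y : AugBar A} (hy : y ∈ degreePart A e)
    (hf : sumBefore (degs ch) j + sumAfter (degs ch) j + e + q = f) :
    insert c ch j y ∈ degreePart A f := by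
  refine map_mem_of_degreePart (fun t ht => ?_) hy
  cases t with
  | leaf a => simp
  | @node k p x u =>
    have hm : n + k - 1 + 1 = n + k := by have := j.pos; omega
    rw [insert_node hm j rfl]
    refine units_smul_mem _ ?_
    have h := cls_mem (node (C.comp hm j rfl x c) (splice hm j ch u))
    rw [degree_node] at h ht
    have h2 := sum_splice (hm := hm) (j := j) (degs ch) (degs u)
    rw [← degs_splice] at h2
    rw [h2] at h
    simp only [degs] at ht hf h
    convert h using 2
    linarith

/-- Sequential associativity. -/
theorem insert_comp_in {k n m : ℕ} (hm : m + 1 = n + k) (j : Fin n) {p q r : ℤ} (hr : p + q = r)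
    (x : (C.obj k).X p) (c : (C.obj n).X q) (ch : Fin n → BarTree A) (u : Fin k → BarTree A)
    (a : Fin k) :
    insert (C.comp hm j hr x c) (splice hm j ch u) (spliceIn hm j a) =
      (p * sumAfter (degs ch) j).negOnePow • insert c ch j ∘ₗ insert x u a := by
  refine hom_ext' (fun a => by simp) fun {l s} y t => ?_
  have h₁ : k + l - 1 + 1 = k + l := by have := a.pos; omega
  have h₂ : m + l - 1 + 1 = m + l := by have := (spliceIn hm j a).pos; omega
  have h₃ : m + l - 1 + 1 = n + (k + l - 1) := by omega
  have e₁ : s + p + q = s + r := by omega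
  rw [insert_node h₂ _ rfl, LinearMap.smul_apply, LinearMap.comp_apply, insert_node h₁ a rfl,
    LinearMap.CompatibleSMul.map_smul, insert_node h₃ j e₁, smul_smul, smul_smul,
    C.comp_assoc h₁ h₃ hm h₂ j a (spliceIn hm j a) rfl rfl e₁ hr rfl y x c,
    splice_splice_in h₁ h₃ hm h₂ j a ch u t]
  congr 1
  rw [degs_splice, sumAfter_spliceIn, ← Int.negOnePow_add, ← Int.negOnePow_add]
  apply Int.negOnePow_congr
  push_cast
  grind

/-- Parallel associativity. -/
theorem insert_comp_out {k l n m₁ m₂ : ℕ} (h₁ : m₁ + 1 = n + k) (h₂ : m₂ + 1 = n + l)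
    (i j : Fin n) (hij : i < j) {p s q r₁ r₂ : ℤ} (hr₁ : p + q = r₁) (hr₂ : s + q = r₂)
    (x : (C.obj k).X p) (y : (C.obj l).X s) (c : (C.obj n).X q) (ch : Fin n → BarTree A)
    (u : Fin k → BarTree A) (t : Fin l → BarTree A) :
    (p * sumAfter (degs ch) j).negOnePow •
      insert (C.comp h₁ j hr₁ x c) (splice h₁ j ch u) (spliceOut h₁ j ⟨i, hij.ne⟩)
        (cls (node y t)) =
    (s * sumAfter (degs ch) i + s * (degs ch j + ∑ b, degs u b + p)).negOnePow •
      insert (C.comp h₂ i hr₂ y c) (splice h₂ i ch t) (spliceOut h₂ i ⟨j, hij.ne'⟩)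
        (cls (node x u)) := by
  have h₁' : m₁ + l - 1 + 1 = m₁ + l := by
    have := (spliceOut h₁ j ⟨i, hij.ne⟩).pos; omega
  have h₂' : m₁ + l - 1 + 1 = m₂ + k := by
    have := (spliceOut h₁ j ⟨i, hij.ne⟩).pos; omega
  have e : p + r₂ = s + r₁ := by omega
  have hi : ((spliceOut h₁ j ⟨i, hij.ne⟩ : Fin m₁) : ℕ) = i := by
    simp [spliceOut, hij]
  have hj : ((spliceOut h₂ i ⟨j, hij.ne'⟩ : Fin m₂) : ℕ) + 1 = j + l := by
    have : (i : ℕ) < j := hij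
    simp only [spliceOut, not_lt_of_gt hij, if_false]
    omega
  rw [insert_node h₁' _ rfl, insert_node h₂' _ e,
    C.comp_comm h₁ h₁' h₂ h₂' i j hij _ hi _ hj hr₁ rfl hr₂ e y x c, cls_node_units_smul,
    splice_splice_out h₁ h₁' h₂ h₂' i j hij ch u t, smul_smul, smul_smul, smul_smul]
  congr 1
  simp only [degs_splice, sumAfter_spliceOut, ← Int.negOnePow_add, hij, not_lt_of_gt hij, if_true,
    if_false]
  apply Int.negOnePow_congr
  push_cast
  grind

/-! ### Corollas labelled by the unit, and the projection to leaves -/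

/-- Attaching a tree to a new root labelled by the unit of the operad. -/
noncomputable def unitNode : AugBar A →ₗ[K] AugBar A :=
  graft C.unit (fun _ => leaf (0 : A.obj.X 0)) 0

theorem unitNode_cls (t : BarTree A) : unitNode (cls t) = cls (node C.unit fun _ => t) := by
  rw [unitNode, graft_cls]
  congr 2
  funext i
  rw [Subsingleton.elim i 0, Function.update_self]

/-- Since `γ_j(1, c) = c`, grafting a tree is the composition of its unit corolla into `c`. Grafting
and edge contraction thus become values of the same map `insert`. -/
theorem insert_unitNode {n : ℕ} {q : ℤ} (c : (C.obj n).X q) (ch : Fin n → BarTree A) (j : Fin n)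
    (t : BarTree A) :
    insert c ch j (unitNode (cls t)) = cls (node c (Function.update ch j t)) := by
  rw [unitNode_cls, insert_node rfl j (zero_add q), C.unit_comp, zero_mul, Int.negOnePow_zero,
    one_smul]
  congr 2
  funext p
  induction p using splice_cases rfl j with
  | out i =>
    have : spliceOut (rfl : n + 1 = n + 1) j i = i.1 := by
      ext
      simp [spliceOut]
    rw [splice_spliceOut, this, Function.update_of_ne i.2]
  | inn a =>
    have : spliceIn (rfl : n + 1 = n + 1) j a = j := by
      ext
      simp [spliceIn]
    rw [splice_spliceIn, this, Function.update_self]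

theorem insert_unit_node {k : ℕ} {p : ℤ} (x : (C.obj k).X p) (u : Fin k → BarTree A)
    (ch : Fin 1 → BarTree A) : insert C.unit ch 0 (cls (node x u)) = cls (node x u) := by
  have h : sumAfter (degs ch) 0 = 0 := by
    refine Finset.sum_eq_zero fun i hi => ?_
    rw [Subsingleton.elim i 0] at hi
    simp at hi
  rw [insert_node (add_comm k 1) 0 (add_zero p), C.comp_unit, h, mul_zero, Int.negOnePow_zero,
    one_smul]
  congr 2
  funext a
  have : a = spliceIn (add_comm k 1) 0 a := by
    ext
    simp [spliceIn]
  conv_lhs => rw [this, splice_spliceIn]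

theorem unitNode_mem {e : ℤ} {y : AugBar A} (hy : y ∈ degreePart A e) :
    unitNode y ∈ degreePart A (e + 1) := by
  refine map_mem_of_degreePart (fun t ht => ?_) hy
  rw [unitNode_cls]
  have := cls_mem (node C.unit fun _ : Fin 1 => t)
  rw [degree_node] at this
  simpa [ht] using this

/-- The class of a leaf, and zero for other trees. -/
noncomputable def leafPartFun : BarTree A → AugBar A
  | leaf a => cls (leaf a)
  | node _ _ => 0

theorem leafPartFun_compatible : Compatible (leafPartFun : BarTree A → AugBar A) where
  leaf_add a b := cls_leaf_add a b
  leaf_smul r a := cls_leaf_smul r a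
  node_add x y u := by simp [leafPartFun]
  node_smul r x u := by simp [leafPartFun]
  node_act τ x u := by simp [leafPartFun]
  update x u a e := ⟨0, fun t _ => by simp [leafPartFun]⟩

/-- The projection to the span of the leaves. -/
noncomputable def leafPart : AugBar A →ₗ[K] AugBar A :=
  lift _ leafPartFun_compatible.rel

@[simp] theorem leafPart_leaf {d : ℤ} (a : A.obj.X d) :
    leafPart (cls (leaf a : BarTree A)) = cls (leaf a) := by
  rw [leafPart, lift_cls, leafPartFun]

@[simp] theorem leafPart_node {k : ℕ} {p : ℤ} (x : (C.obj k).X p) (u : Fin k → BarTree A) :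
    leafPart (cls (node x u)) = 0 := by
  rw [leafPart, lift_cls, leafPartFun]

theorem leafPart_mem {e : ℤ} {y : AugBar A} (hy : y ∈ degreePart A e) :
    leafPart y ∈ degreePart A e := by
  refine map_mem_of_degreePart (fun t ht => ?_) hy
  cases t with
  | leaf a => rw [leafPart_leaf, ← ht]; exact cls_mem _
  | node x u => simp

theorem insert_leafPart {n : ℕ} {q : ℤ} (c : (C.obj n).X q) (ch : Fin n → BarTree A) (j : Fin n)
    (y : AugBar A) : insert c ch j (leafPart y) = 0 := by
  have : insert c ch j ∘ₗ leafPart = 0 := hom_ext' (fun a => by simp) fun x u => by simp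
  exact LinearMap.congr_fun this y

theorem leafPart_insert {n : ℕ} {q : ℤ} (c : (C.obj n).X q) (ch : Fin n → BarTree A) (j : Fin n)
    (y : AugBar A) : leafPart (insert c ch j y) = 0 := by
  have : leafPart ∘ₗ insert c ch j = 0 := by
    refine hom_ext' (fun a => by simp) fun {k p} x u => ?_
    have hm : n + k - 1 + 1 = n + k := by have := j.pos; omega
    rw [LinearMap.comp_apply, insert_node hm j rfl, LinearMap.CompatibleSMul.map_smul,
      leafPart_node, smul_zero, LinearMap.zero_apply]
  exact LinearMap.congr_fun this y

theorem leafPart_unitNode (y : AugBar A) : leafPart (unitNode y) = 0 := by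
  have : leafPart ∘ₗ unitNode = (0 : AugBar A →ₗ[K] AugBar A) :=
    hom_ext fun t => by rw [LinearMap.comp_apply, unitNode_cls, leafPart_node]; rfl
  exact LinearMap.congr_fun this y

end AugBar

end Composition

/-! ### Evaluation of operations on leaves -/

section Evaluation

variable {K : Type u} [Field K] {C : DGOperad.{u, v} K} {A : DGAlgebra.{u, v, w} C}

open BarTree

namespace AugBar

open Classical in
/-- The value in the algebra of an operation whose arguments are leaves, as a leaf; zero if some
argument is not a leaf. -/
noncomputable def eval {k : ℕ} {d : ℤ} (c : (C.obj k).X d) (ch : Fin k → BarTree A) : AugBar A :=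
  if h : ∀ i, (ch i).IsLeaf then
    cls (leaf (A.theta (d := fun i => ((ch i).leafLabel (h i)).1) rfl c
      (fun i => ((ch i).leafLabel (h i)).2)))
  else 0

theorem leaf_theta_congr {k : ℕ} {d : Fin k → ℤ} {e r r' : ℤ} (h : ∑ i, d i + e = r)
    (h' : ∑ i, d i + e = r') (c : (C.obj k).X e) (a : ∀ i, A.obj.X (d i)) :
    leaf (A.theta h c a) = leaf (A.theta h' c a) := by
  obtain rfl : r = r' := by omega
  rfl

theorem eval_leaves {k : ℕ} {d : Fin k → ℤ} {e r : ℤ} (h : ∑ i, d i + e = r) (c : (C.obj k).X e)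
    (a : ∀ i, A.obj.X (d i)) :
    eval c (fun i => (leaf (a i) : BarTree A)) = cls (leaf (A.theta h c a)) := by
  have hl : ∀ i, (leaf (a i) : BarTree A).IsLeaf := fun i => trivial
  rw [eval, dif_pos hl]
  exact congrArg cls (leaf_theta_congr _ _ _ _)

theorem eval_of_node {k : ℕ} {d : ℤ} (c : (C.obj k).X d) (ch : Fin k → BarTree A) (j : Fin k)
    (h : ¬ (ch j).IsLeaf) : eval c ch = 0 :=
  dif_neg fun h' => h (h' j)

theorem exists_eq_leaf {t : BarTree A} (h : t.IsLeaf) : ∃ a : Homog A.obj, t = leaf a.2 := by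
  cases t with
  | leaf a => exact ⟨⟨_, a⟩, rfl⟩
  | node _ _ => exact h.elim

theorem exists_leaves {k : ℕ} (ch : Fin k → BarTree A) :
    (∃ i, ¬ (ch i).IsLeaf) ∨ ∃ a : Fin k → Homog A.obj, ch = fun i => leaf (a i).2 := by
  by_cases h : ∃ i, ¬ (ch i).IsLeaf
  · exact Or.inl h
  · push Not at h
    choose a ha using fun i => exists_eq_leaf (h i)
    exact Or.inr ⟨a, funext ha⟩

/-- In its uses the `j`-th tree is overwritten, so only the others matter; `x` prescribes the
otherwise arbitrary `j`-th label. -/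
theorem exists_leaves_ne {k : ℕ} (ch : Fin k → BarTree A) (j : Fin k) (x : Homog A.obj) :
    (∃ i, i ≠ j ∧ ¬ (ch i).IsLeaf) ∨
      ∃ a : Fin k → Homog A.obj, a j = x ∧ ∀ t, Function.update ch j t =
        Function.update (fun i => leaf (a i).2) j t := by
  rcases exists_leaves (Function.update ch j (leaf x.2)) with ⟨i, hi⟩ | ⟨a, ha⟩
  · left
    have hij : i ≠ j := by
      rintro rfl
      rw [Function.update_self] at hi
      exact hi trivial
    exact ⟨i, hij, by rwa [Function.update_of_ne hij] at hi⟩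
  · right
    refine ⟨Function.update a j x, Function.update_self _ _ _, fun t => ?_⟩
    funext i
    by_cases hij : i = j
    · subst hij
      simp
    · have := congrFun ha i
      rw [Function.update_of_ne hij] at this
      have h2 : Function.update a j x i = a i := Function.update_of_ne hij _ _
      rw [Function.update_of_ne hij, Function.update_of_ne hij, this, h2]

theorem eval_update_leaf {k : ℕ} {d : ℤ} (c : (C.obj k).X d) (a : Fin k → Homog A.obj) (j : Fin k)
    (b : A.obj.X (a j).1) :
    eval c (Function.update (fun i => (leaf (a i).2 : BarTree A)) j (leaf b)) =
      cls (leaf (A.theta rfl c (Function.update (fun i => (a i).2) j b))) := by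
  rw [← eval_leaves]
  congr 1
  funext i
  by_cases hij : i = j
  · subst hij
    simp
  · simp [Function.update_of_ne hij]

theorem eval_add {k : ℕ} {d : ℤ} (c c' : (C.obj k).X d) (ch : Fin k → BarTree A) :
    eval (c + c') ch = eval c ch + eval c' ch := by
  rcases exists_leaves ch with ⟨i, hi⟩ | ⟨a, rfl⟩
  · simp [eval_of_node _ ch i hi]
  · rw [eval_leaves rfl, eval_leaves rfl, eval_leaves rfl, map_add, ← cls_leaf_add]
    rfl

theorem eval_smul {k : ℕ} {d : ℤ} (s : K) (c : (C.obj k).X d) (ch : Fin k → BarTree A) :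
    eval (s • c) ch = s • eval c ch := by
  rcases exists_leaves ch with ⟨i, hi⟩ | ⟨a, rfl⟩
  · simp [eval_of_node _ ch i hi]
  · rw [eval_leaves rfl, eval_leaves rfl, map_smul, ← cls_leaf_smul]
    rfl

theorem cls_leaf_units_smul {d : ℤ} (r : ℤˣ) (a : A.obj.X d) :
    cls (leaf (r • a) : BarTree A) = r • cls (leaf a) := by
  rcases Int.units_eq_one_or r with rfl | rfl
  · simp
  · simpa using cls_leaf_smul (-1) a

theorem eval_act {k : ℕ} {d : ℤ} (σ : Equiv.Perm (Fin k)) (c : (C.obj k).X d)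
    (ch : Fin k → BarTree A) :
    eval (C.act σ c) ch = koszulSign (degs ch) σ • eval c fun i => ch (σ i) := by
  rcases exists_leaves ch with ⟨i, hi⟩ | ⟨a, rfl⟩
  · rw [eval_of_node _ ch i hi, eval_of_node _ _ (σ.symm i) (by simpa using hi), smul_zero]
  · rw [eval_leaves rfl, eval_leaves (Equiv.sum_comp σ (fun i => (a i).1) ▸ rfl :
      ∑ i, (a (σ i)).1 + d = ∑ i, (a i).1 + d), ← cls_leaf_units_smul]
    congr 2
    rw [A.theta_act σ _ (Equiv.sum_comp σ (fun i => (a i).1) ▸ rfl)]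
    congr 2
    funext i
    simp [degs]

theorem eval_mem {k : ℕ} {d : ℤ} (c : (C.obj k).X d) (ch : Fin k → BarTree A) :
    eval c ch ∈ degreePart A (∑ i, degs ch i + d) := by
  rcases exists_leaves ch with ⟨i, hi⟩ | ⟨a, rfl⟩
  · rw [eval_of_node _ ch i hi]
    exact zero_mem _
  · rw [eval_leaves rfl]
    convert cls_mem _ using 2
    simp [degs]

theorem eval_update_node {k l : ℕ} {d e : ℤ} (c : (C.obj k).X d) (ch : Fin k → BarTree A)
    (j : Fin k) (x : (C.obj l).X e) (u : Fin l → BarTree A) :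
    eval c (Function.update ch j (node x u)) = 0 :=
  eval_of_node _ _ j (by simp [IsLeaf])

theorem evalAt_compatible {k : ℕ} {d : ℤ} (c : (C.obj k).X d) (ch : Fin k → BarTree A)
    (j : Fin k) : Compatible fun t => eval c (Function.update ch j t) where
  leaf_add {e} a b := by
    rcases exists_leaves_ne ch j (⟨e, 0⟩ : Homog A.obj) with ⟨i, hij, hi⟩ | ⟨x, hx, h⟩
    · have : ∀ t, eval c (Function.update ch j t) = 0 := fun t =>
        eval_of_node _ _ i (by rwa [Function.update_of_ne hij])
      simp [this]
    · obtain rfl : (x j).1 = e := by rw [hx]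
      rw [h, h, h, eval_update_leaf, eval_update_leaf, eval_update_leaf,
        MultilinearMap.map_update_add, cls_leaf_add]
  leaf_smul {e} r a := by
    rcases exists_leaves_ne ch j (⟨e, 0⟩ : Homog A.obj) with ⟨i, hij, hi⟩ | ⟨x, hx, h⟩
    · have : ∀ t, eval c (Function.update ch j t) = 0 := fun t =>
        eval_of_node _ _ i (by rwa [Function.update_of_ne hij])
      simp [this]
    · obtain rfl : (x j).1 = e := by rw [hx]
      rw [h, h, eval_update_leaf, eval_update_leaf, MultilinearMap.map_update_smul, cls_leaf_smul]
  node_add x y u := by simp [eval_update_node]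
  node_smul r x u := by simp [eval_update_node]
  node_act τ x u := by simp [eval_update_node]
  update x u i e := ⟨0, fun t _ => eval_update_node c ch j x _⟩

/-- The function `eval` as a linear map of the `j`-th argument. -/
noncomputable def evalAt {k : ℕ} {d : ℤ} (c : (C.obj k).X d) (ch : Fin k → BarTree A)
    (j : Fin k) : AugBar A →ₗ[K] AugBar A :=
  lift _ (evalAt_compatible c ch j).rel

@[simp] theorem evalAt_cls {k : ℕ} {d : ℤ} (c : (C.obj k).X d) (ch : Fin k → BarTree A)
    (j : Fin k) (t : BarTree A) :
    evalAt c ch j (cls t) = eval c (Function.update ch j t) := lift_cls _ _ _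

/-- This is associativity of the algebra when all trees involved are leaves. A non-leaf among `u`,
or among the trees of `ch` other than the `j`-th, makes both sides zero; the tree `ch j` plays no
role. -/
theorem eval_comp {k n m : ℕ} (hm : m + 1 = n + k) (j : Fin n) {p q r : ℤ} (hr : p + q = r)
    (x : (C.obj k).X p) (c : (C.obj n).X q) (ch : Fin n → BarTree A) (u : Fin k → BarTree A) :
    eval (C.comp hm j hr x c) (splice hm j ch u) =
      (p * sumAfter (degs ch) j).negOnePow • evalAt c ch j (eval x u) := by
  rcases exists_leaves u with ⟨i, hi⟩ | ⟨a, rfl⟩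
  · rw [eval_of_node _ _ (spliceIn hm j i) (by rwa [splice_spliceIn]), eval_of_node _ _ i hi,
      map_zero, smul_zero]
  · rw [eval_leaves rfl, evalAt_cls]
    rcases exists_leaves_ne ch j ⟨_, A.theta rfl x fun i => (a i).2⟩ with ⟨i, hij, hi⟩ | ⟨b, hb, h⟩
    · rw [eval_of_node _ _ (spliceOut hm j ⟨i, hij⟩) (by rwa [splice_spliceOut]),
        eval_of_node _ _ i (by rwa [Function.update_of_ne hij]), smul_zero]
    · have h1 : splice hm j ch (fun i => (leaf (a i).2 : BarTree A)) =
          fun p => leaf (splice hm j b a p).2 := by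
        rw [splice_map (fun x : Homog A.obj => (leaf x.2 : BarTree A)),
          ← splice_update_self (hm := hm) ch _ (leaf (b j).2), h,
          splice_update_self]
      have h2 : Function.update ch j (leaf (A.theta rfl x fun i => (a i).2)) =
          fun i => leaf (b i).2 := by
        rw [h]
        funext i
        by_cases hij : i = j
        · subst hij
          rw [Function.update_self, hb]
        · rw [Function.update_of_ne hij]
      have h3 : sumAfter (degs ch) j = ∑ i with j < i, (b i).1 := by
        rw [← sumAfter_update_self _ j ((leaf (b j).2 : BarTree A).degree), ← degs_update, h]
        refine Finset.sum_congr rfl fun i hi => ?_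
        rw [degs, Function.update_of_ne (ne_of_gt (by simpa using hi)), degree_leaf]
      have hsum : ∑ i, (splice hm j b a i).1 + r = ∑ i, (b i).1 + q := by
        have e1 := sum_splice (hm := hm) (j := j) (fun i => (b i).1) (fun i => (a i).1)
        rw [← splice_map (fun x : Homog A.obj => x.1)] at e1
        rw [e1, sum_eq_sumBefore_add (fun i => (b i).1) j, hb]
        simp only
        omega
      rw [h1, h2, eval_leaves hsum, eval_leaves rfl, h3, ← cls_leaf_units_smul,
        A.theta_comp hm j hr b a x c rfl hb hsum rfl]

/-- The value in the algebra of a node whose successors are leaves, as a leaf; zero for other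
trees. -/
noncomputable def evalRootFun : BarTree A → AugBar A
  | leaf _ => 0
  | node c ch => eval c ch

theorem evalRootFun_compatible : Compatible (evalRootFun : BarTree A → AugBar A) where
  leaf_add a b := by simp [evalRootFun]
  leaf_smul r a := by simp [evalRootFun]
  node_add x y u := eval_add x y u
  node_smul r x u := eval_smul r x u
  node_act τ x u := eval_act τ x u
  update x u j e := ⟨evalAt x u j ∘ₗ LinearMap.fst K _ _, fun t _ => by simp [evalRootFun]⟩

/-- The value in the algebra of a node whose successors are leaves, as a leaf. -/
noncomputable def evalRoot : AugBar A →ₗ[K] AugBar A :=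
  lift _ evalRootFun_compatible.rel

@[simp] theorem evalRoot_leaf {d : ℤ} (a : A.obj.X d) :
    evalRoot (cls (leaf a : BarTree A)) = 0 := by
  rw [evalRoot, lift_cls, evalRootFun]

@[simp] theorem evalRoot_node {k : ℕ} {p : ℤ} (x : (C.obj k).X p) (u : Fin k → BarTree A) :
    evalRoot (cls (node x u)) = eval x u := by
  rw [evalRoot, lift_cls, evalRootFun]

theorem leafPart_eval {k : ℕ} {d : ℤ} (c : (C.obj k).X d) (ch : Fin k → BarTree A) :
    leafPart (eval c ch) = eval c ch := by
  rcases exists_leaves ch with ⟨i, hi⟩ | ⟨a, rfl⟩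
  · rw [eval_of_node _ _ i hi, map_zero]
  · rw [eval_leaves rfl, leafPart_leaf]

/-- A leaf is recovered from `θ(a; 1) = a`, while a unit corolla over a node cannot be evaluated. -/
theorem evalRoot_unitNode (y : AugBar A) : evalRoot (unitNode y) = leafPart y := by
  have : evalRoot ∘ₗ unitNode = (leafPart : AugBar A →ₗ[K] AugBar A) := by
    refine hom_ext' (fun {d} a => ?_) fun x u => ?_
    · rw [LinearMap.comp_apply, unitNode_cls, evalRoot_node, leafPart_leaf,
        eval_leaves (by simp : ∑ _i : Fin 1, d + 0 = d), A.theta_unit]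
    · rw [LinearMap.comp_apply, unitNode_cls, evalRoot_node, leafPart_node,
        eval_of_node _ _ 0 (by simp [IsLeaf])]
  exact LinearMap.congr_fun this y

end AugBar

end Evaluation

/-! ### The differential in terms of composition, and the contracting homotopy -/

section Differential

variable {K : Type u} [Field K] {C : DGOperad.{u, v} K} {A : DGAlgebra.{u, v, w} C}

open BarTree

namespace AugBar

/-- The combination of operations which results from differentiating an argument of degree `e`,
given the argument and its differential. -/
noncomputable def deriv (e : ℤ) : AugBar A × AugBar A →ₗ[K] AugBar A :=
  unitNode ∘ₗ LinearMap.snd K _ _ +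
    (e - 1).negOnePow • (LinearMap.id - leafPart) ∘ₗ LinearMap.fst K _ _

theorem deriv_apply (e : ℤ) (x y : AugBar A) :
    deriv e (x, y) = unitNode y + (e - 1).negOnePow • (x - leafPart x) := by
  simp [deriv]

theorem deriv_mem {e : ℤ} {x y : AugBar A} (hx : x ∈ degreePart A e)
    (hy : y ∈ degreePart A (e - 1)) : deriv e (x, y) ∈ degreePart A (e - 1 + 1) := by
  rw [deriv_apply]
  refine add_mem (unitNode_mem hy) (units_smul_mem _ ?_)
  rw [sub_add_cancel]
  exact sub_mem hx (leafPart_mem hx)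

/-- The differential of the class of a tree. -/
noncomputable def dFun : BarTree A → AugBar A
  | @leaf _ _ _ _ d a => cls (leaf ((A.obj.d d (d - 1)).hom a))
  | @node _ _ _ _ k d c ch =>
    ∑ j, (sumBefore (degs ch) j).negOnePow •
        insert c ch j (deriv (degree (ch j)) (cls (ch j), dFun (ch j))) +
      (∑ i, degs ch i).negOnePow • cls (node (((C.obj k).d d (d - 1)).hom c) ch) -
      (∑ i, degs ch i + d).negOnePow • eval c ch

theorem dFun_leaf {d : ℤ} (a : A.obj.X d) :
    dFun (leaf a : BarTree A) = cls (leaf ((A.obj.d d (d - 1)).hom a)) := by rw [dFun]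

theorem dFun_node {k : ℕ} {d : ℤ} (c : (C.obj k).X d) (ch : Fin k → BarTree A) :
    dFun (node c ch) = ∑ j, (sumBefore (degs ch) j).negOnePow •
        insert c ch j (deriv (degree (ch j)) (cls (ch j), dFun (ch j))) +
      (∑ i, degs ch i).negOnePow • cls (node (((C.obj k).d d (d - 1)).hom c) ch) -
      (∑ i, degs ch i + d).negOnePow • eval c ch := by rw [dFun]

theorem dFun_mem (t : BarTree A) : dFun t ∈ degreePart A (t.degree - 1) := by
  induction t with
  | leaf a =>
    rw [dFun_leaf, degree_leaf]
    convert cls_mem _ using 2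
    simp
  | @node k d c ch ih =>
    rw [dFun_node, degree_node]
    refine sub_mem (add_mem (sum_mem fun j _ => units_smul_mem _ ?_) (units_smul_mem _ ?_))
      (units_smul_mem _ ?_)
    · refine insert_mem c ch j (deriv_mem (cls_mem _) (ih j)) ?_
      have := sum_eq_sumBefore_add (degs ch) j
      simp only [degs] at this ⊢
      linarith
    · convert cls_mem _ using 2
      rw [degree_node]
      ring
    · convert eval_mem c ch using 2
      ring

/-- A differentiated argument counts as a letter of degree one less. The resulting change of the
Koszul sign is the parity of the degrees before that argument in the old and in the new order, which
matches the prefix signs on the two sides. -/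
theorem dFun_act {k : ℕ} {d : ℤ} (σ : Equiv.Perm (Fin k)) (c : (C.obj k).X d)
    (ch : Fin k → BarTree A) :
    dFun (node (C.act σ c) ch) =
      koszulSign (fun i => degree (ch i)) σ • dFun (node c fun i => ch (σ i)) := by
  rw [dFun_node, dFun_node, smul_sub, smul_add, Finset.smul_sum]
  have hs : ∑ i, degs (fun i => ch (σ i)) i = ∑ i, degs ch i := Equiv.sum_comp σ (degs ch)
  rw [hs]
  congr 1
  · congr 1
    · rw [← Equiv.sum_comp σ]
      refine Finset.sum_congr rfl fun j _ => ?_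
      rw [insert_act c ch j σ (deriv_mem (cls_mem _) (dFun_mem _)), smul_smul, smul_smul,
        koszulSign_update, mul_left_comm, mul_comm (koszulSign (fun i => (ch i).degree) σ), mul_assoc,
        mul_comm (koszulSign _ σ), ← mul_assoc, ← Int.negOnePow_add]
      congr 2
      apply Int.negOnePow_congr
      have : degs (fun i => ch (σ i)) = fun i => degs ch (σ i) := rfl
      rw [this]
      push_cast
      grind
    · rw [C.act_d, cls_node_act, smul_comm]
  · rw [eval_act, smul_comm]

theorem dFun_compatible : Compatible (dFun : BarTree A → AugBar A) where
  leaf_add a b := by rw [dFun_leaf, dFun_leaf, dFun_leaf, map_add, cls_leaf_add]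
  leaf_smul r a := by rw [dFun_leaf, dFun_leaf, map_smul, cls_leaf_smul]
  node_add x y ch := by
    simp only [dFun_node, insert_add, map_add, cls_node_add, eval_add, LinearMap.add_apply,
      smul_add, Finset.sum_add_distrib]
    abel
  node_smul r x ch := by
    simp only [dFun_node, insert_smul, map_smul, cls_node_smul, eval_smul, LinearMap.smul_apply,
      smul_sub, smul_add, Finset.smul_sum, smul_comm r]
  node_act σ x ch := dFun_act σ x ch
  update {k d} x ch j e := by
    have h1 : ∀ i : {i // i ≠ j}, ∃ Φ : AugBar A →ₗ[K] AugBar A, ∀ t : BarTree A, t.degree = e →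
        insert x (Function.update ch j t) i
          (deriv (degree (ch i)) (cls (ch i), dFun (ch i))) = Φ (cls t) := fun i =>
      exists_insert_update x ch j i i.2 e _
    choose Φ hΦ using h1
    -- The differentiated argument involves both `cls t` and its differential, which is why `update`
    -- admits dependence on the pair; all other terms involve `cls t` alone.
    refine ⟨(sumBefore (Function.update (degs ch) j e) j).negOnePow • (insert x ch j ∘ₗ deriv e) +
      (∑ i : {i // i ≠ j}, (sumBefore (Function.update (degs ch) j e) i).negOnePow • Φ i) ∘ₗ
        LinearMap.fst K _ _ +
      (∑ i, Function.update (degs ch) j e i).negOnePow •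
        (graft (((C.obj k).d d (d - 1)).hom x) ch j ∘ₗ LinearMap.fst K _ _) -
      (∑ i, Function.update (degs ch) j e i + d).negOnePow •
        (evalAt x ch j ∘ₗ LinearMap.fst K _ _), fun t ht => ?_⟩
    rw [dFun_node, Fintype.sum_eq_add_sum_subtype_ne _ j, degs_update, ht]
    have h2 : ∀ i : {i // i ≠ j}, Function.update ch j t i = ch i := fun i =>
      Function.update_of_ne i.2 _ _
    simp only [Function.update_self, insert_update_self, ht, h2, hΦ _ t ht, LinearMap.sub_apply,
      LinearMap.add_apply, LinearMap.smul_apply, LinearMap.comp_apply, LinearMap.sum_apply,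
      LinearMap.fst_apply, graft_cls, evalAt_cls]

/-- The differential of the augmented bar construction. -/
noncomputable def dBar : AugBar A →ₗ[K] AugBar A :=
  lift _ dFun_compatible.rel

theorem dBar_cls (t : BarTree A) : dBar (cls t) = dFun t := lift_cls _ _ _

theorem dBar_leaf {d : ℤ} (a : A.obj.X d) :
    dBar (cls (leaf a : BarTree A)) = cls (leaf ((A.obj.d d (d - 1)).hom a)) := by
  rw [dBar_cls, dFun_leaf]

/-- The derivative of an argument of an operation. -/
noncomputable def darg (t : BarTree A) : AugBar A := deriv (degree t) (cls t, dBar (cls t))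

theorem dBar_node {k : ℕ} {d : ℤ} (c : (C.obj k).X d) (ch : Fin k → BarTree A) :
    dBar (cls (node c ch)) = ∑ j, (sumBefore (degs ch) j).negOnePow •
        insert c ch j (darg (ch j)) +
      (∑ i, degs ch i).negOnePow • cls (node (((C.obj k).d d (d - 1)).hom c) ch) -
      (∑ i, degs ch i + d).negOnePow • eval c ch := by
  rw [dBar_cls, dFun_node]
  simp only [darg, dBar_cls]

theorem dBar_mem {e : ℤ} {x : AugBar A} (hx : x ∈ degreePart A e) :
    dBar x ∈ degreePart A (e - 1) :=
  map_mem_of_degreePart (fun t ht => by rw [dBar_cls, ← ht]; exact dFun_mem t) hx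

theorem darg_mem (t : BarTree A) : darg t ∈ degreePart A (t.degree - 1 + 1) :=
  deriv_mem (cls_mem t) (dBar_mem (cls_mem t))

/-- Attaching trees to a new root labelled by the unit is a contracting homotopy, up to sign. -/
theorem dBar_unitNode {e : ℤ} {x : AugBar A} (hx : x ∈ degreePart A e) :
    dBar (unitNode x) = unitNode (dBar x) + (e - 1).negOnePow • x := by
  change (dBar ∘ₗ unitNode) x =
    (unitNode ∘ₗ dBar + (e - 1).negOnePow • LinearMap.id : AugBar A →ₗ[K] AugBar A) x
  refine eq_of_degreePart (fun t ht => ?_) hx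
  change dBar (unitNode (cls t)) = unitNode (dBar (cls t)) + (e - 1).negOnePow • cls t
  -- Composition into the unit fixes nodes and kills leaves. The missing leaf part is supplied by
  -- `eval` in `h2`, so together they return the whole of `t`.
  have h1 : ∀ y, insert C.unit (fun _ : Fin 1 => t) 0 y = y - leafPart y := by
    intro y
    have : insert C.unit (fun _ : Fin 1 => t) 0 = LinearMap.id - leafPart :=
      hom_ext' (fun a => by simp) fun x u => by simp [insert_unit_node]
    rw [this]
    rfl
  have h2 : eval C.unit (fun _ : Fin 1 => t) = leafPart (cls t) := by
    rw [← evalRoot_unitNode, unitNode_cls, evalRoot_node]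
  have h3 : sumBefore (degs fun _ : Fin 1 => t) 0 = 0 := by
    simp [sumBefore]
  rw [unitNode_cls, dBar_node, h2, C.unit_d, Fin.sum_univ_one, h1, h3, darg,
    deriv_apply, ht]
  have h4 : cls (node (0 : (C.obj 1).X (0 - 1)) fun _ : Fin 1 => t) = 0 := by
    have := cls_node_smul (0 : K) (0 : (C.obj 1).X (0 - 1)) (fun _ : Fin 1 => t)
    rwa [zero_smul, zero_smul] at this
  have h5 : (e - 1).negOnePow = - e.negOnePow := by
    rw [Int.negOnePow_sub, Int.negOnePow_one, mul_neg_one]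
  have h6 : leafPart (leafPart (cls t)) = leafPart (cls t) := by
    cases t <;> simp
  rw [h4, Fin.sum_univ_one, add_zero, smul_zero, add_zero, degs, ht, h5, map_add,
    leafPart_unitNode, LinearMap.CompatibleSMul.map_smul, map_sub, h6, sub_self, smul_zero,
    Int.negOnePow_zero, one_smul]
  simp only [Units.neg_smul, smul_sub]
  abel

end AugBar

end Differential

/-! ### The differential squares to zero -/

section SquareZero

variable {K : Type u} [Field K] {C : DGOperad.{u, v} K} {A : DGAlgebra.{u, v, w} C}

open BarTree

namespace AugBar

theorem insert_eval {n k : ℕ} {q p : ℤ} (c : (C.obj n).X q) (ch : Fin n → BarTree A) (j : Fin n)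
    (x : (C.obj k).X p) (u : Fin k → BarTree A) : insert c ch j (eval x u) = 0 := by
  rw [← leafPart_eval, insert_leafPart]

/-- By the homotopy formula `darg t` is, up to sign and a leaf, the boundary of `unitNode (cls t)`.
Hence the boundary of `darg t` is a combination of leaves, which `insert` kills. -/
theorem insert_dBar_darg {n : ℕ} {q : ℤ} (c : (C.obj n).X q) (ch : Fin n → BarTree A) (j : Fin n)
    (t : BarTree A) (ht : dBar (dBar (cls t)) = 0) : insert c ch j (dBar (darg t)) = 0 := by
  have h1 : insert c ch j (dBar (leafPart (cls t))) = 0 := by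
    cases t with
    | leaf a => rw [leafPart_leaf, dBar_leaf, insert_leaf]
    | node x u => simp
  have h2 : (t.degree - 1 - 1).negOnePow = -(t.degree - 1).negOnePow := by
    rw [Int.negOnePow_sub _ 1, Int.negOnePow_one, mul_neg_one]
  rw [darg, deriv_apply, map_add, dBar_unitNode (dBar_mem (cls_mem t)), ht, map_zero, zero_add, h2,
    LinearMap.CompatibleSMul.map_smul, map_sub, smul_sub, Units.neg_smul, neg_add_eq_sub,
    sub_sub_cancel_left, map_neg, LinearMap.CompatibleSMul.map_smul, h1, smul_zero, neg_zero]

/-- The terms of the differential of a composition which involve another argument. -/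
noncomputable def cross {n : ℕ} {q : ℤ} (c : (C.obj n).X q) (ch : Fin n → BarTree A) (j : Fin n)
    (i : {i : Fin n // i ≠ j}) : BarTree A → AugBar A →ₗ[K] AugBar A
  | leaf _ => 0
  | @node _ _ _ _ k p x u =>
    have hm : n + k - 1 + 1 = n + k := by have := j.pos; omega
    (p * sumAfter (degs ch) j + sumBefore (degs (splice hm j ch u)) (spliceOut hm j i)).negOnePow •
      insert (C.comp hm j rfl x c) (splice hm j ch u) (spliceOut hm j i)

/-- A Leibniz rule for composition. For a node, the inputs of the composite split into those of the
inserted operation, which by sequential associativity rebuild part of the differential of `t`, and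
the other inputs of `c`, which give the cross terms. The vertex label contributes by the Leibniz
rule of the operad, and evaluation by associativity of the algebra. -/
theorem dBar_insert {n : ℕ} {q : ℤ} (c : (C.obj n).X q) (ch : Fin n → BarTree A) (j : Fin n)
    (t : BarTree A) :
    dBar (insert c ch j (cls t)) =
      (sumBefore (degs ch) j).negOnePow • insert c ch j (dBar (cls t)) +
        ∑ i, cross c ch j i t (darg (ch i)) +
      (sumBefore (degs ch) j + sumAfter (degs ch) j + t.degree - 1).negOnePow •
        insert (((C.obj n).d q (q - 1)).hom c) ch j (cls t) -
      (sumBefore (degs ch) j + sumAfter (degs ch) j + t.degree - 1 + q).negOnePow •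
        evalAt c ch j (evalRoot (cls t)) := by
  cases t with
  | leaf a => simp [dBar_leaf, cross]
  | @node k p x u =>
    have hm : n + k - 1 + 1 = n + k := by have := j.pos; omega
    have e₁ : p + (q - 1) = p + q - 1 := by ring
    have e₂ : p - 1 + q = p + q - 1 := by ring
    have hdeg := sum_splice (hm := hm) (j := j) (degs ch) (degs u)
    rw [← degs_splice] at hdeg
    have hD := C.comp_d hm j (rfl : p + q = p + q) (sub_add_cancel p 1) (sub_add_cancel q 1)
      (sub_add_cancel (p + q) 1) e₂ e₁ x c
    have hu : (node x u).degree = ∑ i, degs u i + p + 1 := degree_node x u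
    rw [insert_node hm j rfl, LinearMap.CompatibleSMul.map_smul, dBar_node, dBar_node,
      sum_splice_index hm j, hD, cls_node_add, cls_node_units_smul, eval_comp, evalRoot_node,
      insert_node hm j e₁, map_sub, map_add, LinearMap.CompatibleSMul.map_smul (insert c ch j),
      LinearMap.CompatibleSMul.map_smul (insert c ch j), insert_eval, insert_node hm j e₂, map_sum,
      hdeg, hu]
    simp only [splice_spliceIn, splice_spliceOut, insert_comp_in, LinearMap.CompatibleSMul.map_smul,
      cross, LinearMap.smul_apply, LinearMap.comp_apply, smul_sub, smul_add, smul_smul,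
      Finset.smul_sum, smul_zero, sub_zero, degs_splice, sumBefore_spliceIn, ← Int.negOnePow_add]
    -- Here `a` comes from the inputs of the inserted operation, `b` from the remaining inputs, `c`
    -- from `∂x`, `d` from the differential of the outer operation, and `e` from evaluation. Only
    -- signs are left to compare.
    have rearrange : ∀ {a b c d e a' c' d' e' : AugBar A}, a = a' → c = c' → d = d' → e = e' →
        b + a + (c + d) - e = a' + c' + b + d' - e' := by
      rintro a b c d e _ _ _ _ rfl rfl rfl rfl
      abel
    refine rearrange ?_ ?_ ?_ ?_
    · refine Finset.sum_congr rfl fun a _ => ?_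
      congr 1
      apply Int.negOnePow_congr
      push_cast
      grind
    all_goals
      congr 1
      apply Int.negOnePow_congr
      push_cast
      grind

theorem negOnePow_smul_add {a b : ℤ} (h : (a : ZMod 2) = b + 1) (x : AugBar A) :
    a.negOnePow • x + b.negOnePow • x = 0 := by
  rw [Int.negOnePow_congr (b := b + 1) (by push_cast; exact h), Int.negOnePow_succ, Units.neg_smul,
    neg_add_cancel]

/-- By parallel associativity both terms are the same double composition. A node has degree one more
than its successors and its label together, and this shift makes the two signs opposite. -/
theorem cross_add_cross {n : ℕ} {q : ℤ} (c : (C.obj n).X q) (ch : Fin n → BarTree A) (i j : Fin n)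
    (hij : i < j) (s t : BarTree A) (hs : s.degree = (ch j).degree) (ht : t.degree = (ch i).degree) :
    (sumBefore (degs ch) j).negOnePow • cross c ch j ⟨i, hij.ne⟩ s (cls t) +
      (sumBefore (degs ch) i).negOnePow • cross c ch i ⟨j, hij.ne'⟩ t (cls s) = 0 := by
  cases s with
  | leaf a => cases t <;> simp [cross]
  | @node k p x u =>
    cases t with
    | leaf b => simp [cross]
    | @node l s y r =>
      have hm₁ : n + k - 1 + 1 = n + k := by have := j.pos; omega
      have hm₂ : n + l - 1 + 1 = n + l := by have := j.pos; omega
      have hc := insert_comp_out hm₁ hm₂ i j hij rfl rfl x y c ch u r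
      simp only [cross, LinearMap.smul_apply]
      rw [add_comm (p * _), Int.negOnePow_add, mul_smul, hc, smul_smul, smul_smul, smul_smul,
        ← Int.negOnePow_add, ← Int.negOnePow_add, ← Int.negOnePow_add]
      apply negOnePow_smul_add
      rw [degree_node] at hs ht
      have hs' : degs ch j = ∑ b, degs u b + p + 1 := hs.symm
      have ht' : degs ch i = ∑ b, degs r b + s + 1 := ht.symm
      simp only [degs_splice, sumBefore_spliceOut, hij, not_lt_of_gt hij, if_true, if_false, hs',
        ht']
      push_cast
      grind

theorem sum_cross {n : ℕ} {q : ℤ} (c : (C.obj n).X q) (ch : Fin n → BarTree A)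
    (z : Fin n → BarTree A →₀ K) (hz : ∀ i, ∀ t ∈ (z i).support, t.degree = (ch i).degree) :
    ∑ j, (sumBefore (degs ch) j).negOnePow • ∑ i : {i // i ≠ j},
      Finsupp.linearCombination K (cross c ch j i) (z j)
        (Finsupp.linearCombination K cls (z i)) = 0 := by
  have key : ∀ i j : Fin n, ∀ hij : i < j,
      (sumBefore (degs ch) j).negOnePow • Finsupp.linearCombination K (cross c ch j ⟨i, hij.ne⟩) (z j)
        (Finsupp.linearCombination K cls (z i)) +
      (sumBefore (degs ch) i).negOnePow • Finsupp.linearCombination K (cross c ch i ⟨j, hij.ne'⟩)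
        (z i) (Finsupp.linearCombination K cls (z j)) = 0 := by
    intro i j hij
    simp only [Finsupp.linearCombination_apply, Finsupp.sum, LinearMap.sum_apply, map_sum,
      LinearMap.smul_apply, map_smul, Finset.smul_sum]
    rw [Finset.sum_comm, ← Finset.sum_add_distrib]
    refine Finset.sum_eq_zero fun s hs => ?_
    rw [← Finset.sum_add_distrib]
    refine Finset.sum_eq_zero fun t ht => ?_
    have h := cross_add_cross c ch i j hij s t (hz j s hs) (hz i t ht)
    have swap : ∀ (u : ℤˣ) (a b : K) (x : AugBar A), u • a • b • x = a • b • u • x :=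
      fun u a b x => by rw [smul_comm u, smul_comm u]
    rw [swap, swap, smul_comm (z j s) (z i t), ← smul_add, ← smul_add, h, smul_zero, smul_zero]
  simp only [Finset.smul_sum]
  rw [Finset.sum_sigma']
  -- The summand in which `j` is differentiated first and `i` second is matched with the one in the
  -- opposite order.
  refine Finset.sum_involution (fun p _ => ⟨p.2.1, ⟨p.1, p.2.2.symm⟩⟩) ?_ ?_ (fun _ _ => by simp)
    (fun _ _ => rfl)
  · rintro ⟨j, i, hij⟩ _
    rcases lt_or_gt_of_ne hij with h | h
    · exact key i j h
    · rw [add_comm]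
      exact key j i h
  · rintro ⟨j, i, hij⟩ _ _ h
    exact hij (Sigma.mk.inj_iff.1 h).1

theorem evalRoot_darg_leaf {d : ℤ} (a : A.obj.X d) :
    evalRoot (darg (leaf a : BarTree A)) = cls (leaf ((A.obj.d d (d - 1)).hom a)) := by
  rw [darg, deriv_apply, leafPart_leaf, sub_self, smul_zero, add_zero, evalRoot_unitNode,
    dBar_leaf, leafPart_leaf]

/-- Two evaluations cancel: the leaf part of the differential of the node, seen through the unit
corolla, and the evaluation of the node itself in `darg`. -/
theorem evalRoot_darg_node {k : ℕ} {p : ℤ} (x : (C.obj k).X p) (u : Fin k → BarTree A) :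
    evalRoot (darg (node x u)) = 0 := by
  rw [darg, deriv_apply, leafPart_node, sub_zero, map_add, evalRoot_unitNode,
    LinearMap.CompatibleSMul.map_smul, evalRoot_node, dBar_node, map_sub, map_add, map_sum,
    LinearMap.CompatibleSMul.map_smul, LinearMap.CompatibleSMul.map_smul, leafPart_node,
    leafPart_eval, smul_zero, add_zero, degree_node, add_sub_cancel_right, Finset.sum_eq_zero]
  · simp
  · intro j _
    rw [LinearMap.CompatibleSMul.map_smul, leafPart_insert, smul_zero]

/-- Leaves depend linearly on their labels. -/
noncomputable def leafMap (d : ℤ) : A.obj.X d →ₗ[K] AugBar A where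
  toFun a := cls (leaf a)
  map_add' := cls_leaf_add
  map_smul' := cls_leaf_smul

/-- For leaves this is the chain map property of `theta`. If some successor is a node, everything
vanishes: differentiating a leaf leaves that node in place, and differentiating a node gives zero by
`evalRoot_darg_node`. -/
theorem dBar_eval {k : ℕ} {d : ℤ} (c : (C.obj k).X d) (ch : Fin k → BarTree A) :
    dBar (eval c ch) =
      ∑ j, (sumBefore (degs ch) j).negOnePow • evalAt c ch j (evalRoot (darg (ch j))) +
        (∑ i, degs ch i).negOnePow • eval (((C.obj k).d d (d - 1)).hom c) ch := by
  rcases exists_leaves ch with ⟨i, hi⟩ | ⟨a, rfl⟩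
  · rw [eval_of_node _ _ i hi, eval_of_node _ _ i hi, map_zero, smul_zero, add_zero]
    refine (Finset.sum_eq_zero fun j _ => ?_).symm
    have : evalAt c ch j (evalRoot (darg (ch j))) = 0 := by
      rcases hj : ch j with a | ⟨x, u⟩
      · rw [evalRoot_darg_leaf, evalAt_cls]
        have hij : i ≠ j := by
          rintro rfl
          rw [hj] at hi
          exact hi trivial
        exact eval_of_node _ _ i (by rwa [Function.update_of_ne hij])
      · rw [evalRoot_darg_node, map_zero]
    rw [this, smul_zero]
  · have h₂ : ∑ i, (a i).1 + (d - 1) = ∑ i, (a i).1 + d - 1 := by ring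
    have h₁ : ∀ i, ∑ l, (Function.update a i (a i).bdry l).1 + d = ∑ i, (a i).1 + d - 1 := by
      intro i
      have : (fun l => (Function.update a i (a i).bdry l).1) =
          Function.update (fun l => (a l).1) i ((a i).1 - 1) := by
        funext l
        exact Function.apply_update (fun _ (x : Homog A.obj) => x.1) a i (a i).bdry l
      rw [this, sum_update]
      ring
    rw [eval_leaves rfl, dBar_leaf, A.theta_d a rfl (sub_add_cancel d 1) (sub_add_cancel _ 1) h₁ h₂ c,
      eval_leaves h₂]
    change leafMap _ _ = _
    rw [map_add, map_sum, LinearMap.CompatibleSMul.map_smul]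
    have hd : degs (fun i => (leaf (a i).2 : BarTree A)) = fun i => (a i).1 := by
      funext i
      exact degree_leaf _
    rw [hd]
    congr 1
    refine Finset.sum_congr rfl fun j _ => ?_
    rw [LinearMap.CompatibleSMul.map_smul, evalRoot_darg_leaf, evalAt_cls]
    congr 1
    have : Function.update (fun i => (leaf (a i).2 : BarTree A)) j
        (leaf ((A.obj.d (a j).1 ((a j).1 - 1)).hom (a j).2)) =
        fun l => leaf (Function.update a j (a j).bdry l).2 := by
      funext l
      exact (Function.apply_update (fun _ (x : Homog A.obj) => (leaf x.2 : BarTree A)) a j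
        (a j).bdry l).symm
    rw [this, eval_leaves (h₁ j)]
    rfl

theorem cls_node_zero {k : ℕ} {d : ℤ} (ch : Fin k → BarTree A) :
    cls (node (0 : (C.obj k).X d) ch) = 0 := by
  have := cls_node_smul (0 : K) (0 : (C.obj k).X d) ch
  rwa [zero_smul, zero_smul] at this

theorem dBar_dBar_cls (t : BarTree A) : dBar (dBar (cls t)) = 0 := by
  induction t with
  | @leaf d a =>
    rw [dBar_leaf, dBar_leaf]
    have : (A.obj.d (d - 1) (d - 1 - 1)).hom ((A.obj.d d (d - 1)).hom a) = 0 := by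
      rw [← ModuleCat.comp_apply, A.obj.d_comp_d]
      rfl
    rw [this]
    exact map_zero (leafMap _)
  | @node k d c ch ih =>
    -- The map `cross` is defined on trees rather than on classes, so each `darg (ch i)` is
    -- represented once and for all by trees of the degree of `ch i`.
    choose z hz hzd using fun i => exists_rep (darg_mem (ch i))
    simp only [sub_add_cancel] at hz
    have hins : ∀ j, dBar (insert c ch j (darg (ch j))) =
        ∑ i : {i // i ≠ j}, Finsupp.linearCombination K (cross c ch j i) (z j)
          (Finsupp.linearCombination K cls (z i)) +
        (∑ i, degs ch i - 1).negOnePow •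
          insert (((C.obj k).d d (d - 1)).hom c) ch j (darg (ch j)) -
        (∑ i, degs ch i - 1 + d).negOnePow • evalAt c ch j (evalRoot (darg (ch j))) := by
      intro j
      have h0 := insert_dBar_darg c ch j (ch j) (ih j)
      have hsum : sumBefore (degs ch) j + sumAfter (degs ch) j + (ch j).degree = ∑ i, degs ch i := by
        rw [sum_eq_sumBefore_add (degs ch) j]
        simp only [degs]
        ring
      -- All terms of `dBar_insert` other than the cross terms are linear in the class of `t`.
      -- Collected in `F`, they determine the cross terms at the chosen representative of `darg (ch
      -- j)`.
      let F : AugBar A →ₗ[K] AugBar A :=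
        dBar ∘ₗ insert c ch j - (sumBefore (degs ch) j).negOnePow • insert c ch j ∘ₗ dBar -
          (∑ i, degs ch i - 1).negOnePow • insert (((C.obj k).d d (d - 1)).hom c) ch j +
          (∑ i, degs ch i - 1 + d).negOnePow • evalAt c ch j ∘ₗ evalRoot
      have hF : F (darg (ch j)) = ∑ i : {i // i ≠ j},
          Finsupp.linearCombination K (cross c ch j i) (z j) (darg (ch i)) := by
        rw [← hzd j, ← linearCombination_comp]
        have : ∀ t ∈ (z j).support, F (cls t) =
            (∑ i : {i // i ≠ j}, LinearMap.applyₗ (darg (ch i)) ∘ₗ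
              Finsupp.linearCombination K (cross c ch j i)) (Finsupp.single t 1) := by
          intro t ht
          simp only [F, LinearMap.add_apply, LinearMap.sub_apply, LinearMap.smul_apply,
            LinearMap.comp_apply, LinearMap.sum_apply, Finsupp.linearCombination_single, one_smul,
            LinearMap.applyₗ_apply_apply]
          rw [dBar_insert, hz j t ht, hsum]
          abel
        rw [linearCombination_congr this, linearCombination_comp, linearCombination_singles]
        simp
      have hF' : dBar (insert c ch j (darg (ch j))) = F (darg (ch j)) +
          (∑ i, degs ch i - 1).negOnePow •
            insert (((C.obj k).d d (d - 1)).hom c) ch j (darg (ch j)) -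
          (∑ i, degs ch i - 1 + d).negOnePow • evalAt c ch j (evalRoot (darg (ch j))) := by
        simp only [F, LinearMap.add_apply, LinearMap.sub_apply, LinearMap.smul_apply,
          LinearMap.comp_apply, h0, smul_zero]
        abel
      rw [hF', hF]
      simp only [hzd]
    have hdd : ((C.obj k).d (d - 1) (d - 1 - 1)).hom (((C.obj k).d d (d - 1)).hom c) = 0 := by
      rw [← ModuleCat.comp_apply, (C.obj k).d_comp_d]
      rfl
    have hcross := sum_cross c ch z hz
    simp only [Finset.smul_sum] at hcross
    have s1 : (∑ i, degs ch i - 1).negOnePow = -(∑ i, degs ch i).negOnePow := by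
      rw [Int.negOnePow_sub, Int.negOnePow_one, mul_neg_one]
    have s2 : (∑ i, degs ch i - 1 + d).negOnePow = -(∑ i, degs ch i + d).negOnePow := by
      rw [Int.negOnePow_add, s1, neg_mul, Int.negOnePow_add]
    have s3 : (∑ i, degs ch i + (d - 1)).negOnePow = -(∑ i, degs ch i + d).negOnePow := by
      rw [← s2]
      congr 1
      ring
    rw [dBar_node, map_sub, map_add, map_sum, LinearMap.CompatibleSMul.map_smul,
      LinearMap.CompatibleSMul.map_smul, dBar_node, hdd, cls_node_zero, smul_zero, add_zero,
      dBar_eval]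
    simp only [LinearMap.CompatibleSMul.map_smul, hins, smul_sub, smul_add, Finset.sum_sub_distrib,
      Finset.sum_add_distrib, hcross, s1, s2, s3, Units.neg_smul, smul_neg, Finset.smul_sum,
      Finset.sum_neg_distrib, smul_comm (sumBefore _ _).negOnePow (∑ i, degs ch i).negOnePow,
      smul_comm (sumBefore _ _).negOnePow (∑ i, degs ch i + d).negOnePow,
      smul_comm (∑ i, degs ch i).negOnePow (∑ i, degs ch i + d).negOnePow]
    abel

end AugBar

end SquareZero

/-! ### The shuffle exponent under changes of one entry and substitution -/

theorem shuffleExp_eq {n : ℕ} (e f : Fin n → ℤ) : shuffleExp e f = ∑ i, f i * sumAfter e i := by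
  simp only [shuffleExp, sumBefore, sumAfter, Finset.sum_filter, Finset.sum_mul, Finset.mul_sum]
  rw [Finset.sum_comm]
  refine Finset.sum_congr rfl fun i _ => Finset.sum_congr rfl fun j _ => ?_
  split_ifs <;> simp

theorem shuffleExp_update_left {n : ℕ} (e f : Fin n → ℤ) (j : Fin n) (x : ℤ) :
    shuffleExp (Function.update e j x) f = shuffleExp e f + sumBefore f j * (x - e j) := by
  have h : ∀ i : {i // i ≠ j}, Function.update e j x i = e i := fun i =>
    Function.update_of_ne i.2 _ _
  rw [shuffleExp, shuffleExp, Fintype.sum_eq_add_sum_subtype_ne _ j,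
    Fintype.sum_eq_add_sum_subtype_ne (fun i => sumBefore f i * e i) j]
  simp only [h, Function.update_self]
  ring

theorem shuffleExp_update_right {n : ℕ} (e f : Fin n → ℤ) (j : Fin n) (x : ℤ) :
    shuffleExp e (Function.update f j x) = shuffleExp e f + (x - f j) * sumAfter e j := by
  have h : ∀ i : {i // i ≠ j}, Function.update f j x i = f i := fun i =>
    Function.update_of_ne i.2 _ _
  rw [shuffleExp_eq, shuffleExp_eq, Fintype.sum_eq_add_sum_subtype_ne _ j,
    Fintype.sum_eq_add_sum_subtype_ne (fun i => f i * sumAfter e i) j]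
  simp only [h, Function.update_self]
  ring

theorem sumBefore_update_of_ne {n : ℕ} (w : Fin n → ℤ) (j : Fin n) (x : ℤ)
    (i : {i : Fin n // i ≠ j}) : sumBefore (Function.update w j x) i =
      sumBefore w i + if j < i.1 then x - w j else 0 := by
  have h : ∀ i : {i // i ≠ j}, Function.update w j x i = w i := fun i =>
    Function.update_of_ne i.2 _ _
  rw [sumBefore, sumBefore, Finset.sum_filter, Finset.sum_filter,
    Fintype.sum_eq_add_sum_subtype_ne _ j,
    Fintype.sum_eq_add_sum_subtype_ne (fun l => if l < i.1 then w l else 0) j]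
  simp only [h, Function.update_self]
  split_ifs <;> ring

/-- The block is first sorted against the other entries as a whole, with its total `e`- and
`f`-degrees, and then internally. -/
theorem shuffleExp_splice {k n m : ℕ} (hm : m + 1 = n + k) (j : Fin n) (e f : Fin n → ℤ)
    (e' f' : Fin k → ℤ) : shuffleExp (splice hm j e e') (splice hm j f f') =
      shuffleExp (Function.update e j (∑ a, e' a)) (Function.update f j (∑ a, f' a)) +
        shuffleExp e' f' := by
  have h : ∀ i : {i // i ≠ j}, Function.update e j (∑ a, e' a) i = e i := fun i =>
    Function.update_of_ne i.2 _ _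
  rw [shuffleExp, sum_splice_index hm j, shuffleExp, Fintype.sum_eq_add_sum_subtype_ne _ j]
  simp only [splice_spliceIn, splice_spliceOut, sumBefore_spliceIn, sumBefore_spliceOut, h,
    Function.update_self, sumBefore_update_of_ne, sumBefore_update_self, add_mul,
    Finset.sum_add_distrib, ← Finset.mul_sum, shuffleExp]
  ring

/-! ### Comparison with the original signs, grading and homology -/

section Comparison

variable {K : Type u} [Field K] {C : DGOperad.{u, v} K} {A : DGAlgebra.{u, v, w} C}

namespace BarTree

/-- Combinations of trees with given number of nodes and given degree of the labels. -/
def bihom (K : Type u) [Field K] {C : DGOperad.{u, v} K} (A : DGAlgebra.{u, v, w} C) (n l : ℤ) :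
    Submodule K (BarTree A →₀ K) :=
  Finsupp.supported K K {t | numNodes t = n ∧ labelDeg t = l}

theorem single_mem_bihom {n l : ℤ} {t : BarTree A} (r : K) (hn : numNodes t = n)
    (hl : labelDeg t = l) : Finsupp.single t r ∈ bihom K A n l :=
  Finsupp.single_mem_supported K r ⟨hn, hl⟩

theorem plug_mem_bihom {k : ℕ} {d : ℤ} (c : (C.obj k).X d) (ch : Fin k → BarTree A) (j : Fin k)
    {n l n' l' : ℤ} {z : BarTree A →₀ K} (hz : z ∈ bihom K A n l)
    (hn : numNodes (node c ch) - numNodes (ch j) + n = n')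
    (hl : labelDeg (node c ch) - labelDeg (ch j) + l = l') : plug c ch j z ∈ bihom K A n' l' := by
  classical
  intro t ht
  obtain ⟨s, hs, rfl⟩ := Finset.mem_image.1 (Finsupp.mapDomain_support ht)
  obtain ⟨h1, h2⟩ := hz hs
  rw [numNodes_node] at hn
  rw [labelDeg_node] at hl
  constructor
  · rw [numNodes_node, apply_update numNodes, sum_update, h1, ← hn]
    ring
  · rw [labelDeg_node, apply_update labelDeg, sum_update, h2, ← hl]
    ring

theorem edgeContr_mem (t : BarTree A) : edgeContr t ∈ bihom K A (t.numNodes - 1) t.labelDeg := by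
  induction t with
  | leaf a => rw [edgeContr]; exact zero_mem _
  | @node k d c ch ih =>
    rw [edgeContr]
    refine sum_mem fun j _ => add_mem (AugBar.units_smul_mem _
      (plug_mem_bihom c ch j (ih j) (by ring) (by ring))) ?_
    have hj1 := sum_eq_sumBefore_add (fun i => numNodes (ch i)) j
    have hj2 := sum_eq_sumBefore_add (fun i => labelDeg (ch i)) j
    rcases h : ch j with a | ⟨x, u⟩
    · rw [rootEdge]; exact zero_mem _
    · rw [rootEdge]
      rw [h] at hj1 hj2
      refine AugBar.units_smul_mem _ (single_mem_bihom _ ?_ ?_)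
      · rw [numNodes_node, numNodes_node, splice_map numNodes, sum_splice, hj1, numNodes_node]
        ring
      · rw [labelDeg_node, labelDeg_node, splice_map labelDeg, sum_splice, hj2, labelDeg_node]
        ring

theorem leafContr_mem (t : BarTree A) : leafContr t ∈ bihom K A (t.numNodes - 1) t.labelDeg := by
  induction t with
  | leaf a => rw [leafContr]; exact zero_mem _
  | @node k d c ch ih =>
    rw [leafContr]
    refine add_mem (sum_mem fun j _ => AugBar.units_smul_mem _
      (plug_mem_bihom c ch j (ih j) (by ring) (by ring))) ?_
    split_ifs with h
    · rcases AugBar.exists_leaves ch with ⟨i, hi⟩ | ⟨a, rfl⟩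
      · exact absurd (h i) hi
      · refine single_mem_bihom _ ?_ ?_
        · simp [numNodes_node]
        · rw [labelDeg_leaf, labelDeg_node]
          simp only [labelDeg_leaf]
          rfl
    · exact zero_mem _

theorem internalDiff_mem (t : BarTree A) :
    internalDiff t ∈ bihom K A t.numNodes (t.labelDeg - 1) := by
  induction t with
  | leaf a =>
    rw [internalDiff]
    exact single_mem_bihom _ (by simp) (by simp)
  | @node k d c ch ih =>
    rw [internalDiff]
    refine add_mem (sum_mem fun j _ => AugBar.units_smul_mem _
      (plug_mem_bihom c ch j (ih j) (by ring) (by ring)))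
      (AugBar.units_smul_mem _ (single_mem_bihom _ ?_ ?_))
    · rw [numNodes_node, numNodes_node]
    · rw [labelDeg_node, labelDeg_node]
      ring

/-- Signs square to one, so only the effect of changing the two degrees of the `j`-th subtree
survives; the summand `1` comes from moving the root's `e` past the `f`'s of that subtree. -/
theorem twist_mul_twistRest {k : ℕ} {d : ℤ} (c : (C.obj k).X d) (ch : Fin k → BarTree A)
    (j : Fin k) (n l : ℤ) : (node c ch).twist * twistRest d ch j n l = (ch j).twist *
      (sumBefore (fun i => labelDeg (ch i)) j * (n - numNodes (ch j)) +
        (l - labelDeg (ch j)) * (sumAfter (fun i => numNodes (ch i)) j + 1)).negOnePow := by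
  have h : (node c ch).twist = _ := Function.update_eq_self j ch ▸ twist_node_update c ch j (ch j)
  rw [h, twistRest, twistRest, mul_assoc, mul_mul_mul_comm, Int.units_mul_self, one_mul,
    ← Int.negOnePow_add]
  congr 1
  apply Int.negOnePow_congr
  rw [shuffleExp_update_right, shuffleExp_update_left, sumAfter_update_self, shuffleExp_update_right,
    shuffleExp_update_left, sumAfter_update_self, sum_update, sum_update]
  push_cast
  grind

end BarTree

open BarTree

namespace AugBar

theorem mk_plug {k : ℕ} {d : ℤ} (c : (C.obj k).X d) (ch : Fin k → BarTree A) (j : Fin k)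
    {n l : ℤ} {z : BarTree A →₀ K} (hz : z ∈ bihom K A n l) :
    mk A (plug c ch j z) = twistRest d ch j n l • insert c ch j (unitNode (mk A z)) := by
  have h1 : ∀ t ∈ z.support, (mk A ∘ₗ plug c ch j) (Finsupp.single t 1) =
      (twistRest d ch j n l • (insert c ch j ∘ₗ unitNode ∘ₗ mk A)) (Finsupp.single t 1) := by
    intro t ht
    obtain ⟨h1, h2⟩ := hz ht
    simp only [LinearMap.comp_apply, LinearMap.smul_apply]
    rw [mk_single t, LinearMap.CompatibleSMul.map_smul, LinearMap.CompatibleSMul.map_smul,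
      insert_unitNode, BarTree.plug, Finsupp.lmapDomain_apply, Finsupp.mapDomain_single, mk_single,
      twist_node_update, h1, h2, smul_smul, mul_comm]
  have h2 := linearCombination_congr h1
  rw [linearCombination_comp, linearCombination_comp, linearCombination_singles] at h2
  exact h2

theorem twist_smul_mk_plug {k : ℕ} {d : ℤ} (c : (C.obj k).X d) (ch : Fin k → BarTree A)
    (j : Fin k) {n l s b : ℤ} {z : BarTree A →₀ K} (hz : z ∈ bihom K A n l)
    (h : ((s + (sumBefore (fun i => labelDeg (ch i)) j * (n - numNodes (ch j)) +
      (l - labelDeg (ch j)) * (sumAfter (fun i => numNodes (ch i)) j + 1)) : ℤ) : ZMod 2) = b) :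
    (node c ch).twist • s.negOnePow • mk A (plug c ch j z) =
      b.negOnePow • insert c ch j (unitNode ((ch j).twist • mk A z)) := by
  rw [mk_plug c ch j hz, LinearMap.CompatibleSMul.map_smul, LinearMap.CompatibleSMul.map_smul,
    smul_smul, smul_smul, smul_smul, mul_right_comm, twist_mul_twistRest, mul_assoc,
    ← Int.negOnePow_add, mul_comm b.negOnePow]
  congr 2
  apply Int.negOnePow_congr
  rw [← h]
  push_cast
  ring

/-- After twisting, contraction of the edge below `ch j` is composition, with the sign that `deriv`
attaches to its argument. -/
theorem twist_smul_mk_rootEdge {k : ℕ} {d : ℤ} (c : (C.obj k).X d) (ch : Fin k → BarTree A)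
    (j : Fin k) : (node c ch).twist • mk A (rootEdge c ch j (ch j)) =
      (sumBefore (degs ch) j + (degree (ch j) - 1)).negOnePow • insert c ch j (cls (ch j)) := by
  have hj2 := sum_eq_sumBefore_add (fun i => labelDeg (ch i)) j
  have ht : (node c ch).twist = _ := twist_node c ch
  rw [Fintype.prod_eq_mul_prod_subtype_ne _ j] at ht
  rcases h : ch j with a | @⟨l, p, x, u⟩
  · rw [rootEdge, insert_leaf, map_zero, smul_zero, smul_zero]
  · have hm : k + l - 1 + 1 = k + l := by have := j.pos; omega
    have hn' : numNodes (ch j) = ∑ i, numNodes (u i) + 1 := by rw [h, numNodes_node]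
    have hl' : labelDeg (ch j) = ∑ i, labelDeg (u i) + p := by rw [h, labelDeg_node]
    rw [rootEdge, LinearMap.CompatibleSMul.map_smul, mk_single, insert_node hm j rfl, smul_smul,
      smul_smul, smul_smul]
    congr 1
    rw [ht, h, twist_node, twist_node, prod_splice_index hm j]
    simp only [splice_spliceIn, splice_spliceOut]
    rw [splice_map numNodes, splice_map labelDeg, shuffleExp_splice, sum_splice,
      shuffleExp_update_right, shuffleExp_update_left, sumAfter_update_self]
    rw [hj2]
    have e1 : ∀ a b c d e f : ℤˣ, a * b * c * d * e * (c * a * f) = b * d * e * f := by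
      intro a b c d e f
      calc _ = (a * a) * (c * c) * (b * d * e * f) := by ac_rfl
        _ = _ := by rw [Int.units_mul_self, Int.units_mul_self, one_mul, one_mul]
    rw [e1, ← Int.negOnePow_add, ← Int.negOnePow_add, ← Int.negOnePow_add,
      ← Int.negOnePow_add]
    apply Int.negOnePow_congr
    have e2 : sumBefore (degs ch) j = sumBefore (fun i => labelDeg (ch i)) j +
        sumBefore (fun i => numNodes (ch i)) j := Finset.sum_add_distrib
    have e3 : sumAfter (degs ch) j = sumAfter (fun i => labelDeg (ch i)) j +
        sumAfter (fun i => numNodes (ch i)) j := Finset.sum_add_distrib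
    have e4 : ∑ i with i < j, numNodes (ch i) = sumBefore (fun i => numNodes (ch i)) j := rfl
    have e5 : ∑ i with j < i, labelDeg (ch i) = sumAfter (fun i => labelDeg (ch i)) j := rfl
    rw [e2, e3, e4, e5, hn', hl', degree, numNodes_node, labelDeg_node]
    push_cast
    grind

/-- In the original signs, contractions count the preceding `e`'s and internal differentials the
preceding `f`'s. After twisting, an operation inside the `j`-th subtree always carries the parity of
the total degree before it, so all three parts recombine into `dFun`. -/
theorem twist_smul_mk_diff (t : BarTree A) : t.twist • mk A t.diff = dFun t := by
  induction t with
  | leaf a =>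
    rw [BarTree.diff, edgeContr, leafContr, internalDiff, dFun_leaf, numNodes_leaf]
    simp [cls]
  | @node k d c ch ih =>
    have e2 : ∀ j, sumBefore (degs ch) j = sumBefore (fun i => labelDeg (ch i)) j +
        sumBefore (fun i => numNodes (ch i)) j := fun j => Finset.sum_add_distrib
    have e6 : ∑ i, degs ch i = ∑ i, labelDeg (ch i) + ∑ i, numNodes (ch i) :=
      Finset.sum_add_distrib
    have e4 : ∀ j, ∑ i with i < j, numNodes (ch i) = sumBefore (fun i => numNodes (ch i)) j :=
      fun _ => rfl
    have e5 : ∀ j, ∑ i with i < j, labelDeg (ch i) = sumBefore (fun i => labelDeg (ch i)) j :=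
      fun _ => rfl
    have hE : (node c ch).twist • mk A (edgeContr (node c ch)) =
        ∑ j, ((sumBefore (degs ch) j).negOnePow •
          insert c ch j (unitNode ((ch j).twist • mk A (edgeContr (ch j)))) +
          (sumBefore (degs ch) j + (degree (ch j) - 1)).negOnePow •
            insert c ch j (cls (ch j))) := by
      rw [edgeContr, map_sum, Finset.smul_sum]
      refine Finset.sum_congr rfl fun j _ => ?_
      rw [map_add, smul_add, twist_smul_mk_rootEdge, LinearMap.CompatibleSMul.map_smul,
        twist_smul_mk_plug c ch j (edgeContr_mem (ch j))]
      rw [e4, e2]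
      push_cast
      grind
    have hL : (node c ch).twist • mk A (leafContr (node c ch)) =
        ∑ j, (sumBefore (degs ch) j).negOnePow •
          insert c ch j (unitNode ((ch j).twist • mk A (leafContr (ch j)))) +
        (∑ i, degs ch i + d).negOnePow • eval c ch := by
      rw [leafContr, map_add, smul_add, map_sum, Finset.smul_sum]
      congr 1
      · refine Finset.sum_congr rfl fun j _ => ?_
        rw [LinearMap.CompatibleSMul.map_smul, twist_smul_mk_plug c ch j (leafContr_mem (ch j))]
        rw [e4, e2]
        push_cast
        grind
      · rw [eval]
        split_ifs with h
        · rcases exists_leaves ch with ⟨i, hi⟩ | ⟨a, rfl⟩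
          · exact absurd (h i) hi
          · rw [cls, twist_leaf, one_smul, twist_node]
            congr 1
            simp [shuffleExp, degs]
        · rw [map_zero, smul_zero, smul_zero]
    have hI : (node c ch).twist • (node c ch).numNodes.negOnePow • mk A (internalDiff (node c ch)) =
        ∑ j, (sumBefore (degs ch) j).negOnePow •
          insert c ch j (unitNode ((ch j).twist • (ch j).numNodes.negOnePow •
            mk A (internalDiff (ch j)))) +
        (∑ i, degs ch i).negOnePow • cls (node (((C.obj k).d d (d - 1)).hom c) ch) := by
      rw [internalDiff, map_add, smul_add, smul_add, map_sum, Finset.smul_sum, Finset.smul_sum]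
      congr 1
      · refine Finset.sum_congr rfl fun j _ => ?_
        rw [LinearMap.CompatibleSMul.map_smul, smul_smul _ _ (mk A (plug c ch j _)),
          ← Int.negOnePow_add, smul_comm (ch j).twist, LinearMap.CompatibleSMul.map_smul unitNode,
          LinearMap.CompatibleSMul.map_smul (insert c ch j),
          smul_smul (sumBefore (degs ch) j).negOnePow, ← Int.negOnePow_add,
          twist_smul_mk_plug c ch j (internalDiff_mem (ch j))]
        rw [e5, e2, numNodes_node, sum_eq_sumBefore_add (fun i => numNodes (ch i)) j]
        push_cast
        grind
      · rw [LinearMap.CompatibleSMul.map_smul, mk_single, twist_node, twist_node, smul_smul,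
          smul_smul, smul_smul, numNodes_node, e6]
        congr 1
        have e1 : ∀ a b c d e : ℤˣ, a * b * c * d * (a * e) = b * c * d * e := by
          intro a b c d e
          calc _ = (a * a) * (b * c * d * e) := by ac_rfl
            _ = _ := by rw [Int.units_mul_self, one_mul]
        rw [e1, ← Int.negOnePow_add, ← Int.negOnePow_add, ← Int.negOnePow_add]
        apply Int.negOnePow_congr
        push_cast
        grind
    rw [BarTree.diff, map_add, map_sub, LinearMap.CompatibleSMul.map_smul, smul_add, smul_sub, hE,
      hL, hI, dFun_node]
    -- As `insert` kills the leaf part, what remains beside the grafted differential of `ch j` is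
    -- the contraction of its root edge.
    have hj : ∀ j, insert c ch j (deriv (ch j).degree (cls (ch j), dFun (ch j))) =
        insert c ch j (unitNode ((ch j).twist • mk A (edgeContr (ch j)))) -
        insert c ch j (unitNode ((ch j).twist • mk A (leafContr (ch j)))) +
        insert c ch j (unitNode ((ch j).twist • (ch j).numNodes.negOnePow •
            mk A (internalDiff (ch j)))) +
        ((ch j).degree - 1).negOnePow • insert c ch j (cls (ch j)) := by
      intro j
      rw [deriv_apply, ← ih j, BarTree.diff, map_add (insert c ch j),
        LinearMap.CompatibleSMul.map_smul (insert c ch j), map_sub (insert c ch j),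
        insert_leafPart, sub_zero, map_add (mk A), map_sub (mk A),
        LinearMap.CompatibleSMul.map_smul (mk A), smul_add, smul_sub, map_add, map_sub, map_add,
        map_sub]
    simp only [hj, smul_add, smul_sub, Finset.sum_add_distrib, Finset.sum_sub_distrib, smul_smul,
      Int.negOnePow_add]
    abel

/-! ### The grading -/

/-- Multiplication of the homogeneous parts by scalars. -/
noncomputable def degreeScaleFun (f : ℤ → K) (t : BarTree A) : AugBar A := f t.degree • cls t

theorem degreeScaleFun_compatible (f : ℤ → K) :
    Compatible (degreeScaleFun f : BarTree A → AugBar A) where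
  leaf_add a b := by simp only [degreeScaleFun, degree_leaf, cls_leaf_add, smul_add]
  leaf_smul r a := by simp only [degreeScaleFun, degree_leaf, cls_leaf_smul, smul_comm r]
  node_add x y u := by simp only [degreeScaleFun, degree_node, cls_node_add, smul_add]
  node_smul r x u := by simp only [degreeScaleFun, degree_node, cls_node_smul, smul_comm r]
  node_act τ x u := by
    simp only [degreeScaleFun, degree_node, cls_node_act, Equiv.sum_comp τ fun i => degree (u i)]
    rw [smul_comm]
  update {l d} x u j e := by
    refine ⟨f (∑ i, Function.update (degs u) j e i + d + 1) • graft x u j ∘ₗ LinearMap.fst K _ _,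
      fun t ht => ?_⟩
    rw [degreeScaleFun, degree_node, ← ht, ← degs_update]
    simp

/-- Multiplication of the homogeneous parts by scalars. -/
noncomputable def degreeScale (f : ℤ → K) : AugBar A →ₗ[K] AugBar A :=
  lift _ (degreeScaleFun_compatible f).rel

theorem degreeScale_cls (f : ℤ → K) (t : BarTree A) :
    degreeScale f (cls t) = f t.degree • cls t := lift_cls _ _ _

theorem degreeScale_apply (f : ℤ → K) {k : ℤ} {x : AugBar A} (hx : x ∈ degreePart A k) :
    degreeScale f x = f k • x := by
  change degreeScale f x = (f k • LinearMap.id : AugBar A →ₗ[K] AugBar A) x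
  exact eq_of_degreePart (fun t ht => by rw [degreeScale_cls, ht]; rfl) hx

/-- The grading descends to the quotient, so scaling each degree by a prescribed scalar is well
defined; the indicator function of `k` projects onto degree `k` and kills the others. -/
theorem isInternal_degreePart : DirectSum.IsInternal (degreePart A) := by
  classical
  rw [DirectSum.isInternal_submodule_iff_iSupIndep_and_iSup_eq_top]
  constructor
  · intro k
    rw [Submodule.disjoint_def]
    intro x hx hx'
    let f : ℤ → K := fun i => if i = k then 1 else 0
    have h2 : (⨆ j, ⨆ (_ : j ≠ k), degreePart A j) ≤ LinearMap.ker (degreeScale f) := by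
      refine iSup₂_le fun j hj y hy => ?_
      rw [LinearMap.mem_ker, degreeScale_apply f hy]
      simp [f, hj]
    have h1 := degreeScale_apply f hx
    rw [LinearMap.mem_ker.1 (h2 hx')] at h1
    simpa [f] using h1.symm
  · rw [eq_top_iff, ← span_cls]
    refine Submodule.span_le.2 ?_
    rintro _ ⟨t, rfl⟩
    exact Submodule.mem_iSup_of_mem _ (cls_mem t)

theorem dBar_comp_dBar : dBar ∘ₗ dBar = (0 : AugBar A →ₗ[K] AugBar A) :=
  hom_ext fun t => dBar_dBar_cls t

theorem exists_dBar_eq {k : ℤ} {x : AugBar A} (hx : x ∈ degreePart A k) (h : dBar x = 0) :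
    ∃ y ∈ degreePart A (k + 1), dBar y = x := by
  refine ⟨(k - 1).negOnePow • unitNode x, units_smul_mem _ (unitNode_mem hx), ?_⟩
  rw [LinearMap.CompatibleSMul.map_smul, dBar_unitNode hx, h, map_zero, zero_add, smul_smul,
    Int.units_mul_self, one_smul]

theorem ker_dBar : LinearMap.ker (dBar : AugBar A →ₗ[K] AugBar A) = LinearMap.range dBar := by
  apply le_antisymm
  · intro x hx
    -- The sign in the homotopy formula depends on the degree, so for inhomogeneous cycles it is
    -- absorbed into `S`. As `S` anticommutes with the differential, it preserves cycles, and
    -- `unitNode (S x)` is a primitive of `x`.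
    let S : AugBar A →ₗ[K] AugBar A := degreeScale fun k => (((k - 1).negOnePow : ℤ) : K)
    have hS : ∀ {k : ℤ} {y : AugBar A}, y ∈ degreePart A k → S y = (k - 1).negOnePow • y :=
      fun hy => by
        rw [degreeScale_apply _ hy, Units.smul_def, Int.cast_smul_eq_zsmul]
    have h1 : dBar ∘ₗ S = -(S ∘ₗ dBar) := hom_ext fun t => by
      rw [LinearMap.comp_apply, hS (cls_mem t), LinearMap.neg_apply, LinearMap.comp_apply,
        hS (dBar_mem (cls_mem t)), LinearMap.CompatibleSMul.map_smul, ← Units.neg_smul,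
        Int.negOnePow_sub _ 1, Int.negOnePow_sub _ 1, Int.negOnePow_sub _ 1, Int.negOnePow_one]
      simp
    have h2 : dBar ∘ₗ unitNode ∘ₗ S = unitNode ∘ₗ dBar ∘ₗ S + LinearMap.id := hom_ext fun t => by
      simp only [LinearMap.comp_apply, LinearMap.add_apply, LinearMap.id_apply]
      rw [hS (cls_mem t), LinearMap.CompatibleSMul.map_smul, LinearMap.CompatibleSMul.map_smul,
        dBar_unitNode (cls_mem t), smul_add, smul_smul, Int.units_mul_self, one_smul,
        LinearMap.CompatibleSMul.map_smul, LinearMap.CompatibleSMul.map_smul]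
    have h3 : dBar (S x) = 0 := by
      have := LinearMap.congr_fun h1 x
      simpa [LinearMap.mem_ker.1 hx] using this
    have h4 := LinearMap.congr_fun h2 x
    simp only [LinearMap.comp_apply, LinearMap.add_apply, LinearMap.id_apply, h3, map_zero,
      zero_add] at h4
    exact ⟨_, h4⟩
  · rintro _ ⟨y, rfl⟩
    exact LinearMap.congr_fun dBar_comp_dBar y

end AugBar

end Comparison

theorem mainTheorem4 {K : Type u} [Field K] (C : DGOperad.{u, v} K) (A : DGAlgebra.{u, v, w} C) :
    DirectSum.IsInternal (AugBar.degreePart A) ∧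
    ∃ d : AugBar A →ₗ[K] AugBar A,
      (∀ t : BarTree A, d (AugBar.mk A (Finsupp.single t 1)) = AugBar.mk A t.diff) ∧
      (∀ k : ℤ, ∀ x ∈ AugBar.degreePart A k, d x ∈ AugBar.degreePart A (k - 1)) ∧
      d ∘ₗ d = 0 ∧
      LinearMap.ker d = LinearMap.range d ∧
      (∀ k : ℤ, ∀ x ∈ AugBar.degreePart A k, d x = 0 →
        ∃ y ∈ AugBar.degreePart A (k + 1), d y = x) := by
  refine ⟨AugBar.isInternal_degreePart, AugBar.dBar, fun t => ?_, fun k x hx => AugBar.dBar_mem hx,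
    AugBar.dBar_comp_dBar, AugBar.ker_dBar, fun k x hx h => AugBar.exists_dBar_eq hx h⟩
  rw [AugBar.mk_single, LinearMap.CompatibleSMul.map_smul, AugBar.dBar_cls,
    ← AugBar.twist_smul_mk_diff, smul_smul, Int.units_mul_self, one_smul]
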